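/- A Markov decision process (MDP) has a countable set $S$ of states, each of which is controlled or random, a transition relation $\to$ on $S$ under which every state has at least one successor, for every random state a probability distribution over its successors, and a real reward $r(s,s')$ for every transition $s\to s'$. It is finitely branching if every state has finitely many successors, and acyclic if $(S,\to)$ has no directed cycle. The total reward is implicit in the state (with respect to an initial state $s_0$) if for every state $s$ all finite paths from $s_0$ to $s$ have the same sum of rewards. A strategy $\sigma$ maps every finite history ending in a controlled state to a probability distribution over the successors of that state; together with $s_0$ it induces a probability measure $\mathcal P_{s_0,\sigma}$ on the runs from $s_0$. Let $\mathit{MP}$ be the set of runs $\rho_0\rho_1\rho_2\cdots$ with $\liminf_{n\to\infty}\frac1n\sum_{j=0}^{n-1} r(\rho_j,\rho_{j+1})\ge 0$; the value of $s_0$ is $\sup_\sigma \mathcal P_{s_0,\sigma}(\mathit{MP})$ over all strategies $\sigma$, and $\sigma$ is $\varepsilon$-optimal from $s_0$ if $\mathcal P_{s_0,\sigma}(\mathit{MP})$ is at least this value minus $\varepsilon$. A strategy is implemented by a memory set $Q$ with an initial mode and a map $\tau$ that assigns to each mode $m\in Q$ and state $s$ a probability distribution $\tau(m,s)$ on pairs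 (next mode, next state), supported on successors of $s$ if $s$ is controlled, and with the prescribed distribution of the next state if $s$ is random, if after every history of positive probability it plays the next-state marginal of $\tau(m,s)$ averaged over the conditional distribution of the current mode $m$ given the history. It is a finite-memory randomized (FR) strategy if it is implemented by some finite $Q$. It uses a reward counter plus finite memory if it is implemented by some $Q=F\times\mathbb R$ with $F$ finite, where the second component is $0$ initially and is always increased by exactly the reward of the transition taken. Theorem. There exist a countable, finitely branching, acyclic MDP $\mathcal M_{RI}$ and an initial state $s_0$, with the total reward implicit in the state, such that: 1. the value of $s_0$ for $\mathit{MP}$ is $1$; 2. $\mathcal P_{s_0,\sigma}(\mathit{MP})=0$ for every FR strategy $\sigma$; 3. consequently, for every $\varepsilon\in[0,1)$, no strategy that uses a reward counter plus finite memory is $\varepsilon$-optimal from $s_0$ for $\mathit{MP}$. -/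

import Mathlib

/-- A Markov decision process with state set `S`: controlled states (the other states are random),
a transition relation without dead ends, a probability function on random states, and real
transition rewards.  The values of `prob` on controlled states and of `reward` on pairs that are
not transitions are never used. -/
structure MDP (S : Type) where
  ctrl : Set S
  trans : S → S → Prop
  prob : S → PMF S
  reward : S → S → ℝ
  exists_succ : ∀ s, ∃ s', trans s s'
  prob_supp : ∀ s, s ∉ ctrl → ∀ s' ∈ (prob s).support, trans s s'

/-- A history `s₀ s₁ … sₙ` is a function on the indices `0, …, n`. -/
abbrev Hist (S : Type) (n : ℕ) : Type := Finset.Iic n → S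

/-- The current (last) state of a history. -/
def Hist.last {S : Type} {n : ℕ} (h : Hist S n) : S := h ⟨n, Finset.mem_Iic.2 le_rfl⟩

/-- The history made of the first `n + 1` states of a sequence of states. -/
def histOf {S : Type} (ρ : ℕ → S) (n : ℕ) : Hist S n := fun i => ρ i

namespace MDP

variable {S : Type}

/-- Every state has finitely many successors. -/
def FinitelyBranching (M : MDP S) : Prop := ∀ s, {s' | M.trans s s'}.Finite

/-- The transition graph has no directed cycle. -/
def Acyclic (M : MDP S) : Prop := ∀ s, ¬ Relation.TransGen M.trans s s

/-- Sum of the rewards of the first `n` transitions of a sequence of states. -/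
noncomputable def totalReward (M : MDP S) (ρ : ℕ → S) (n : ℕ) : ℝ :=
  ∑ j ∈ Finset.range n, M.reward (ρ j) (ρ (j + 1))

/-- The total reward is implicit in the state: it is a function of the current state on all
finite paths from `s₀`. -/
def RewardImplicit (M : MDP S) (s₀ : S) : Prop :=
  ∃ R : S → ℝ, ∀ (ρ : ℕ → S) (n : ℕ), ρ 0 = s₀ →
    (∀ i < n, M.trans (ρ i) (ρ (i + 1))) → M.totalReward ρ n = R (ρ n)

/-- The objective: the limit inferior, in the extended reals, of the mean payoffs is `≥ 0`. -/
def meanPayoff (M : MDP S) : Set (ℕ → S) :=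
  {ρ | 0 ≤ Filter.liminf (fun n : ℕ => ((M.totalReward ρ n / n : ℝ) : EReal)) Filter.atTop}

/-- General (history dependent, randomized) strategies: to each history that ends in a controlled
state they assign a distribution over the successors of that state. The values on
histories that end in a random state are never used. -/
structure Strategy (M : MDP S) where
  act : (n : ℕ) → Hist S n → PMF S
  act_supp : ∀ (n : ℕ) (h : Hist S n), h.last ∈ M.ctrl →
    ∀ s' ∈ (act n h).support, M.trans h.last s'

open Classical in
/-- The distribution of the next state after a history. -/
noncomputable def Strategy.next {M : MDP S} (σ : M.Strategy) (n : ℕ) (h : Hist S n) : PMF S :=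
  if h.last ∈ M.ctrl then σ.act n h else M.prob h.last

section Measure

variable [Countable S] [MeasurableSpace S] [DiscreteMeasurableSpace S]

/-- The one-step transition kernel from histories to the next state. -/
noncomputable def Strategy.kernel {M : MDP S} (σ : M.Strategy) (n : ℕ) :
    ProbabilityTheory.Kernel (Hist S n) S where
  toFun h := (σ.next n h).toMeasure
  measurable' := measurable_of_countable _

instance {M : MDP S} (σ : M.Strategy) (n : ℕ) :
    ProbabilityTheory.IsMarkovKernel (σ.kernel n) where
  isProbabilityMeasure h := PMF.toMeasure.isProbabilityMeasure (σ.next n h)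

/-- The probability measure on runs induced by a strategy and an initial state (Ionescu-Tulcea
extension of the products of the one-step probabilities). -/
noncomputable def Strategy.prob {M : MDP S} (σ : M.Strategy) (s₀ : S) :
    MeasureTheory.Measure (ℕ → S) :=
  ProbabilityTheory.Kernel.traj (X := fun _ => S) σ.kernel 0 (fun _ => s₀)

/-- The value of a state: supremum over all strategies of the probability of the objective. -/
noncomputable def value (M : MDP S) (φ : Set (ℕ → S)) (s₀ : S) : ENNReal :=
  ⨆ σ : M.Strategy, σ.prob s₀ φ

/-- `σ` is `ε`-optimal from `s₀`: it attains the objective with probability at least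
the value minus `ε`. -/
def Strategy.EpsOptimal {M : MDP S} (σ : M.Strategy) (φ : Set (ℕ → S)) (s₀ : S) (ε : ℝ) : Prop :=
  M.value φ s₀ ≤ σ.prob s₀ φ + ENNReal.ofReal ε

end Measure

/-- A randomized memory update together with an initial mode: in mode `m` and state `s` it draws
the next mode and the next state.  In controlled states the next state is a successor,
in random states it is distributed according to the MDP. -/
structure Memory (M : MDP S) (Q : Type) where
  init : Q
  step : Q → S → PMF (Q × S)
  step_ctrl : ∀ m s, s ∈ M.ctrl → ∀ p ∈ (step m s).support, M.trans s p.2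
  step_rand : ∀ m s, s ∉ M.ctrl → (step m s).map Prod.snd = M.prob s

open Classical in
/-- In the Markov chain on modes and states given by `τ`, started in the initial mode and in
`ρ 0`: the probability that the first `n + 1` states are `ρ 0, …, ρ n` and that the mode
after these is `m`. -/
noncomputable def Memory.weight {M : MDP S} {Q : Type} (τ : M.Memory Q) (ρ : ℕ → S) :
    ℕ → Q → ENNReal
  | 0, m => if m = τ.init then 1 else 0
  | n + 1, m => ∑' m₀, τ.weight ρ n m₀ * τ.step m₀ (ρ n) (m, ρ (n + 1))

/-- `τ` implements `σ` from `s₀`: after every history, `σ` plays the successor distribution of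
`τ` averaged over the conditional distribution of the memory mode given the history.
(Both sides are multiplied by the probability of the history, so that nothing is demanded
after a history of probability zero, where that conditional distribution does not exist.) -/
def Memory.Implements {M : MDP S} {Q : Type} (τ : M.Memory Q) (s₀ : S) (σ : M.Strategy) : Prop :=
  ∀ (ρ : ℕ → S) (n : ℕ), ρ 0 = s₀ → ρ n ∈ M.ctrl → ∀ s' : S,
    (∑' m, τ.weight ρ n m) * σ.act n (histOf ρ n) s' =
      ∑' m, τ.weight ρ n m * ∑' m', τ.step m (ρ n) (m', s')

/-- Finite-memory randomized strategies. -/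
def Strategy.FiniteMemory {M : MDP S} (σ : M.Strategy) (s₀ : S) : Prop :=
  ∃ (Q : Type) (_ : Finite Q) (τ : M.Memory Q), τ.Implements s₀ σ

/-- The memory consists of a component in `F` and of a reward counter, which starts at `0` and is
increased by the reward of each transition taken. -/
def Memory.HasRewardCounter {M : MDP S} {F : Type} (τ : M.Memory (F × ℝ)) : Prop :=
  τ.init.2 = 0 ∧
    ∀ f x s, ∀ p ∈ (τ.step (f, x) s).support, p.1.2 = x + M.reward s p.2

/-- Randomized strategies that use a reward counter plus finite memory. -/
def Strategy.FiniteMemoryRewardCounter {M : MDP S} (σ : M.Strategy) (s₀ : S) : Prop :=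
  ∃ (F : Type) (_ : Finite F) (τ : M.Memory (F × ℝ)), τ.HasRewardCounter ∧ τ.Implements s₀ σ

end MDP

open MeasureTheory ProbabilityTheory Finset
open scoped ENNReal

/-! ### Supermartingale bounds for the measure on runs -/

namespace MDP

variable {S : Type}

/-! The MDP is a ladder of stages. In stage `n`, of size `k = e n`, an index `i ≤ k` is drawn with
probability `ratio k ^ i / norm k`, and the run waits for `delay e n i` steps. All waits end in the
same controlled state `wait n 0`, so the index survives only in the clock and in the memory. The
player then picks `j ≤ k`. The run dips to total reward `-depth e n j`, or, with probability `risk k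
j = 1 / ratio k ^ (j + 1)`, to the still deeper top dip `dip n (k + 1)`, and returns to `0`. Depths
are factorials, so a dip with `j ≤ i` costs at most about `1 / n` in the mean, whereas a dip with `j
> i`, and the top dip, push the mean payoff to `-1` or below.

Picking `j = i`, which the clock allows, fails only through the risk, with probability `∑ i, ratio k
^ i / norm k / ratio k ^ (i + 1) = 2⁻¹ ^ (k + 1) / norm k`. A player who treats two indices `i < i'`
alike loses at least `1 / norm k`: on `i` if `j > i`, and otherwise on `i'`, because `ratio k ^ i' /
ratio k ^ (j + 1) ≥ 1` (`inv_norm_le_delayProb_mul_modeLoss`). If each size `k` occurs in exactly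
`norm k` stages (`exists_stageSizes`), the first losses sum to a finite number and the second ones
diverge.

So matching the index wins almost surely by Borel–Cantelli (`prob_matching_meanPayoff`). With
finitely many modes, as soon as `k` is at least their number, the pigeonhole principle finds one
mode carrying a fixed share of two indices. The optimal safety probability then grows by a factor `1
+ c n` from stage to stage, with `∑ c n = ⊤`, while bounded by `1`, so it is `0` at the start
(`stageSup_zero_eq_zero`). Rewards are differences of a potential of the states, so a reward counter
carries no information and can be dropped (`implements_dropCounter`). -/

theorem tsum_toMeasure_mul [Countable S] [MeasurableSpace S] [DiscreteMeasurableSpace S]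
    (p : PMF S) (f : S → ℝ≥0∞) : ∫⁻ s, f s ∂p.toMeasure = ∑' s, p s * f s := by
  rw [lintegral_countable']
  refine tsum_congr fun s => ?_
  rw [PMF.toMeasure_apply_singleton _ _ (MeasurableSet.singleton s), mul_comm]

/-- Extend a history to a sequence of states that is eventually constant. -/
def extendHist {n : ℕ} (h : Hist S n) : ℕ → S :=
  fun i => if hi : i ≤ n then h ⟨i, Finset.mem_Iic.2 hi⟩ else h.last

theorem histOf_extendHist {n : ℕ} (h : Hist S n) : histOf (extendHist h) n = h := by
  funext i
  simp [histOf, extendHist, Finset.mem_Iic.1 i.2]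

theorem extendHist_histOf (ρ : ℕ → S) (n : ℕ) {i : ℕ} (hi : i ≤ n) :
    extendHist (histOf ρ n) i = ρ i := by
  simp [histOf, extendHist, hi]

/-- A sequence of functionals on runs of which the `n`-th depends only on the first `n + 1`
states. -/
def Adapted {α : Type*} (F : ℕ → (ℕ → S) → α) : Prop :=
  ∀ n ρ ρ', (∀ i ≤ n, ρ i = ρ' i) → F n ρ = F n ρ'

/-- The sequence `ρ` starts in `s₀` and its first `n` steps are transitions. -/
def IsPath (M : MDP S) (s₀ : S) (n : ℕ) (ρ : ℕ → S) : Prop :=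
  ρ 0 = s₀ ∧ ∀ i < n, M.trans (ρ i) (ρ (i + 1))

/-- The sequence `ρ` starts in `s₀` and its first `n` steps have positive probability. -/
def Strategy.IsPlay {M : MDP S} (σ : M.Strategy) (s₀ : S) (n : ℕ) (ρ : ℕ → S) : Prop :=
  ρ 0 = s₀ ∧ ∀ i < n, σ.next i (histOf ρ i) (ρ (i + 1)) ≠ 0

theorem histOf_congr {n : ℕ} {ρ ρ' : ℕ → S} (h : ∀ i ≤ n, ρ i = ρ' i) :
    histOf ρ n = histOf ρ' n :=
  funext fun i => h i (Finset.mem_Iic.1 i.2)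

theorem Strategy.isPlay_congr {M : MDP S} (σ : M.Strategy) {s₀ : S} {n : ℕ} {ρ ρ' : ℕ → S}
    (h : ∀ i ≤ n, ρ i = ρ' i) : σ.IsPlay s₀ n ρ ↔ σ.IsPlay s₀ n ρ' := by
  refine and_congr (by rw [h 0 (Nat.zero_le n)]) (forall₂_congr fun i hi => ?_)
  rw [h (i + 1) hi, histOf_congr fun j hj => h j (hj.trans hi.le)]

theorem update_eq_of_le (ρ : ℕ → S) (n : ℕ) (s : S) {i : ℕ} (hi : i ≤ n) :
    Function.update ρ (n + 1) s i = ρ i :=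
  Function.update_of_ne (by omega) _ _

theorem Strategy.isPlay_succ_update {M : MDP S} (σ : M.Strategy) {s₀ : S} {n : ℕ} {ρ : ℕ → S}
    {s : S} : σ.IsPlay s₀ (n + 1) (Function.update ρ (n + 1) s) ↔
      σ.IsPlay s₀ n ρ ∧ σ.next n (histOf ρ n) s ≠ 0 := by
  have h1 : σ.IsPlay s₀ (n + 1) (Function.update ρ (n + 1) s) ↔
      σ.IsPlay s₀ n (Function.update ρ (n + 1) s) ∧
        σ.next n (histOf (Function.update ρ (n + 1) s) n) (Function.update ρ (n + 1) s (n + 1)) ≠ 0 := by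
    simp only [IsPlay, Nat.forall_lt_succ_right, and_assoc]
  rw [h1, σ.isPlay_congr fun i hi => update_eq_of_le ρ n s hi, Function.update_self,
    histOf_congr fun i hi => update_eq_of_le ρ n s hi]

theorem Strategy.trans_of_next_ne_zero {M : MDP S} (σ : M.Strategy) {n : ℕ} {ρ : ℕ → S} {s : S}
    (h : σ.next n (histOf ρ n) s ≠ 0) : M.trans (ρ n) s := by
  unfold Strategy.next at h
  split_ifs at h with hc
  · exact σ.act_supp n _ hc s h
  · exact M.prob_supp _ hc s h

theorem Strategy.IsPlay.isPath {M : MDP S} {σ : M.Strategy} {s₀ : S} {n : ℕ} {ρ : ℕ → S}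
    (h : σ.IsPlay s₀ n ρ) : M.IsPath s₀ n ρ :=
  ⟨h.1, fun i hi => σ.trans_of_next_ne_zero (h.2 i hi)⟩

section Measure

variable [Countable S] [MeasurableSpace S] [DiscreteMeasurableSpace S]

theorem Adapted.measurable {F : ℕ → (ℕ → S) → ℝ≥0∞} (hF : Adapted F) (n : ℕ) :
    Measurable (F n) := by
  have h1 : Measurable fun h : Hist S n => F n (extendHist h) := measurable_of_countable _
  have h2 : F n = (fun h : Hist S n => F n (extendHist h)) ∘ Preorder.frestrictLe n := by
    funext ρ
    exact hF _ _ _ fun i hi => (extendHist_histOf ρ n hi).symm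
  rw [h2]
  exact h1.comp (by fun_prop)

/-- The expectation of a nonnegative supermartingale does not increase. The induction runs over the
laws of finite histories, where every function is measurable. -/
theorem Strategy.lintegral_le_of_superharmonic {M : MDP S} (σ : M.Strategy) (s₀ : S)
    (F : ℕ → (ℕ → S) → ℝ≥0∞) (hF : Adapted F)
    (hs : ∀ n ρ, ∑' s, σ.next n (histOf ρ n) s * F (n + 1) (Function.update ρ (n + 1) s) ≤ F n ρ)
    (n : ℕ) : ∫⁻ ρ, F n ρ ∂σ.prob s₀ ≤ F 0 (fun _ => s₀) := by
  have key : ∀ n, ∫⁻ h : Hist S n, F n (extendHist h)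
      ∂(Kernel.partialTraj (X := fun _ => S) σ.kernel 0 n (fun _ => s₀)) ≤ F 0 (fun _ => s₀) := by
    intro n
    induction n with
    | zero =>
      rw [Kernel.partialTraj_self, Kernel.id_apply, lintegral_dirac]
      exact le_of_eq (hF 0 _ _ fun i hi => by simp [extendHist, hi])
    | succ n ih =>
      refine le_trans ?_ ih
      rw [Kernel.partialTraj_succ_of_le (Nat.zero_le n), Kernel.map_apply _ (by fun_prop),
        lintegral_map (measurable_of_countable _) (by fun_prop),
        Kernel.lintegral_comp _ _ _ (by
          have : Measurable fun h : Hist S (n + 1) => F (n + 1) (extendHist h) :=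
            measurable_of_countable _
          exact this.comp measurable_IicProdIoc)]
      refine lintegral_mono fun h => ?_
      rw [Kernel.lintegral_id_prod (by
          have : Measurable fun h : Hist S (n + 1) => F (n + 1) (extendHist h) :=
            measurable_of_countable _
          exact this.comp measurable_IicProdIoc),
        Kernel.map_apply _ (by fun_prop), lintegral_map (by
          have : Measurable fun h : Hist S (n + 1) => F (n + 1) (extendHist h) :=
            measurable_of_countable _
          exact (this.comp measurable_IicProdIoc).comp (by fun_prop)) (by fun_prop)]
      have h1 := hs n (extendHist h)
      rw [histOf_extendHist] at h1
      refine le_trans (le_of_eq ?_) h1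
      refine Eq.trans ?_ (tsum_toMeasure_mul (σ.next n h) _)
      change ∫⁻ s, _ ∂(σ.next n h).toMeasure = _
      refine lintegral_congr fun s => hF _ _ _ fun i hi => ?_
      rcases Nat.lt_or_ge n i with hlt | hle
      · obtain rfl : i = n + 1 := by omega
        simp [extendHist, IicProdIoc, MeasurableEquiv.piSingleton]
      · have hne : i ≠ n + 1 := by omega
        simp [extendHist, IicProdIoc, hle, hi, hne]
  refine le_trans (le_of_eq ?_) (key n)
  rw [← Kernel.traj_map_frestrictLe_apply, lintegral_map (measurable_of_countable _) (by fun_prop)]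
  exact lintegral_congr fun ρ => hF _ _ _ fun i hi => (extendHist_histOf ρ n hi).symm

/-- The indicator of having taken a step of probability zero is superharmonic and vanishes at the
start. -/
theorem Strategy.ae_isPlay {M : MDP S} (σ : M.Strategy) (s₀ : S) :
    ∀ᵐ ρ ∂σ.prob s₀, ∀ n, σ.IsPlay s₀ n ρ := by
  classical
  rw [ae_all_iff]
  intro n
  let F : ℕ → (ℕ → S) → ℝ≥0∞ := fun n ρ => if σ.IsPlay s₀ n ρ then 0 else 1
  have hF : Adapted F := fun n ρ ρ' h => by simp only [F, σ.isPlay_congr h]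
  have hle : ∀ n ρ, F n ρ ≤ 1 := fun n ρ => by simp only [F]; split_ifs <;> simp
  have hs : ∀ n ρ, ∑' s, σ.next n (histOf ρ n) s * F (n + 1) (Function.update ρ (n + 1) s)
      ≤ F n ρ := by
    intro n ρ
    by_cases hp : σ.IsPlay s₀ n ρ
    · have : F n ρ = 0 := if_pos hp
      rw [this, nonpos_iff_eq_zero, ENNReal.tsum_eq_zero]
      intro s
      by_cases h0 : σ.next n (histOf ρ n) s = 0
      · rw [h0, zero_mul]
      · have : F (n + 1) (Function.update ρ (n + 1) s) = 0 :=
          if_pos (σ.isPlay_succ_update.2 ⟨hp, h0⟩)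
        rw [this, mul_zero]
    · have : F n ρ = 1 := if_neg hp
      rw [this]
      calc _ ≤ ∑' s, σ.next n (histOf ρ n) s * 1 :=
            ENNReal.tsum_le_tsum fun s => by gcongr; exact hle _ _
        _ = 1 := by simp [PMF.tsum_coe]
  have h := σ.lintegral_le_of_superharmonic s₀ F hF hs n
  have h0 : F 0 (fun _ => s₀) = 0 := if_pos ⟨rfl, fun i hi => absurd hi (Nat.not_lt_zero i)⟩
  rw [h0, nonpos_iff_eq_zero] at h
  rw [lintegral_eq_zero_iff (hF.measurable n)] at h
  filter_upwards [h] with ρ hρ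
  by_contra hc
  simp [F, hc] at hρ

theorem Strategy.lintegral_le_of_superharmonic_on_plays {M : MDP S} (σ : M.Strategy) (s₀ : S)
    (F : ℕ → (ℕ → S) → ℝ≥0∞) (hF : Adapted F)
    (hs : ∀ n ρ, σ.IsPlay s₀ n ρ →
      ∑' s, σ.next n (histOf ρ n) s * F (n + 1) (Function.update ρ (n + 1) s) ≤ F n ρ)
    (n : ℕ) : ∫⁻ ρ, F n ρ ∂σ.prob s₀ ≤ F 0 (fun _ => s₀) := by
  classical
  let G : ℕ → (ℕ → S) → ℝ≥0∞ := fun n ρ => if σ.IsPlay s₀ n ρ then F n ρ else 0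
  have hG : Adapted G := fun n ρ ρ' h => by simp only [G, σ.isPlay_congr h, hF n ρ ρ' h]
  have h1 : ∫⁻ ρ, F n ρ ∂σ.prob s₀ = ∫⁻ ρ, G n ρ ∂σ.prob s₀ := by
    refine lintegral_congr_ae ?_
    filter_upwards [σ.ae_isPlay s₀] with ρ hρ
    exact (if_pos (hρ n)).symm
  have h2 : G 0 (fun _ => s₀) ≤ F 0 (fun _ => s₀) := by
    simp only [G]; split_ifs <;> simp
  rw [h1]
  refine le_trans (σ.lintegral_le_of_superharmonic s₀ G hG (fun n ρ => ?_) n) h2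
  by_cases hp : σ.IsPlay s₀ n ρ
  · refine le_trans (ENNReal.tsum_le_tsum fun s => ?_) ((hs n ρ hp).trans_eq (if_pos hp).symm)
    gcongr
    simp only [G]; split_ifs <;> simp
  · refine le_of_eq_of_le (ENNReal.tsum_eq_zero.2 fun s => ?_) zero_le
    have : G (n + 1) (Function.update ρ (n + 1) s) = 0 :=
      if_neg fun h => hp (σ.isPlay_succ_update.1 h).1
    rw [this, mul_zero]

/-- Markov's inequality at level `1`. This is the form in which all later probability estimates are
obtained. -/
theorem Strategy.prob_le_of_superharmonic {M : MDP S} (σ : M.Strategy) (s₀ : S)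
    (F : ℕ → (ℕ → S) → ℝ≥0∞) (hF : Adapted F)
    (hs : ∀ n ρ, σ.IsPlay s₀ n ρ →
      ∑' s, σ.next n (histOf ρ n) s * F (n + 1) (Function.update ρ (n + 1) s) ≤ F n ρ)
    (n : ℕ) (E : Set (ℕ → S)) (hE : ∀ ρ ∈ E, (∀ k, σ.IsPlay s₀ k ρ) → 1 ≤ F n ρ) :
    σ.prob s₀ E ≤ F 0 (fun _ => s₀) := by
  refine le_trans ?_ (σ.lintegral_le_of_superharmonic_on_plays s₀ F hF hs n)
  calc σ.prob s₀ E ≤ σ.prob s₀ {ρ | 1 ≤ F n ρ} := by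
        refine measure_mono_ae ?_
        filter_upwards [σ.ae_isPlay s₀] with ρ hρ hE'
        exact hE ρ hE' hρ
    _ ≤ ∫⁻ ρ, F n ρ ∂σ.prob s₀ := by
        simpa using mul_meas_ge_le_lintegral (hF.measurable n) 1

end Measure

end MDP

/-! ### The chain on memory modes and states -/

namespace MDP

variable {S : Type}

section Memory

variable {M : MDP S} {Q : Type}

theorem Memory.weight_congr (τ : M.Memory Q) {ρ ρ' : ℕ → S} :
    ∀ {n : ℕ}, (∀ i ≤ n, ρ i = ρ' i) → τ.weight ρ n = τ.weight ρ' n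
  | 0, _ => rfl
  | n + 1, h => by
    funext m
    simp only [Memory.weight]
    rw [τ.weight_congr fun i hi => h i (hi.trans (Nat.le_succ n)), h n (Nat.le_succ n),
      h (n + 1) le_rfl]

theorem Memory.weight_succ_update (τ : M.Memory Q) (ρ : ℕ → S) (n : ℕ) (s : S) (m : Q) :
    τ.weight (Function.update ρ (n + 1) s) (n + 1) m =
      ∑' m₀, τ.weight ρ n m₀ * τ.step m₀ (ρ n) (m, s) := by
  simp only [Memory.weight]
  rw [τ.weight_congr fun i hi => update_eq_of_le ρ n s hi, update_eq_of_le ρ n s le_rfl,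
    Function.update_self]

theorem Memory.trans_of_step_ne_zero (τ : M.Memory Q) {m : Q} {s : S} {p : Q × S}
    (h : τ.step m s p ≠ 0) : M.trans s p.2 := by
  by_cases hc : s ∈ M.ctrl
  · exact τ.step_ctrl m s hc p h
  · refine M.prob_supp s hc p.2 ?_
    rw [← τ.step_rand m s hc, PMF.support_map]
    exact ⟨p, h, rfl⟩

theorem pmf_map_snd_apply {α β : Type*} (p : PMF (α × β)) (b : β) :
    p.map Prod.snd b = ∑' a, p (a, b) := by
  classical
  rw [PMF.map_apply, ENNReal.tsum_prod']
  refine tsum_congr fun a => ?_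
  rw [tsum_eq_single b fun b' hb' => if_neg fun h => hb' h.symm, if_pos rfl]

theorem Memory.tsum_step_eq_prob (τ : M.Memory Q) {m : Q} {s : S} (hs : s ∉ M.ctrl) (s' : S) :
    ∑' m', τ.step m s (m', s') = M.prob s s' := by
  rw [← τ.step_rand m s hs, pmf_map_snd_apply]

/-- The total weight of a history evolves like its probability under `σ`: in controlled states by
the definition of implementation, in random states because the memory respects the prescribed law.
-/
theorem Memory.Implements.tsum_weight_succ {τ : M.Memory Q} {s₀ : S} {σ : M.Strategy}
    (h : τ.Implements s₀ σ) {ρ : ℕ → S} (h0 : ρ 0 = s₀) (n : ℕ) (s : S) :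
    ∑' m, τ.weight (Function.update ρ (n + 1) s) (n + 1) m =
      (∑' m, τ.weight ρ n m) * σ.next n (histOf ρ n) s := by
  simp only [τ.weight_succ_update]
  rw [ENNReal.tsum_comm]
  simp only [ENNReal.tsum_mul_left]
  by_cases hc : ρ n ∈ M.ctrl
  · have h1 : σ.next n (histOf ρ n) = σ.act n (histOf ρ n) := if_pos hc
    rw [h1, h ρ n h0 hc s]
  · have h1 : σ.next n (histOf ρ n) = M.prob (ρ n) := if_neg hc
    rw [h1, ← ENNReal.tsum_mul_right]
    exact tsum_congr fun m => by rw [τ.tsum_step_eq_prob hc]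

theorem Memory.Implements.tsum_weight_le_one {τ : M.Memory Q} {s₀ : S} {σ : M.Strategy}
    (h : τ.Implements s₀ σ) {ρ : ℕ → S} (h0 : ρ 0 = s₀) : ∀ n, ∑' m, τ.weight ρ n m ≤ 1
  | 0 => by
    classical
    simp [Memory.weight]
  | n + 1 => by
    have h1 := h.tsum_weight_succ h0 n (ρ (n + 1))
    rw [Function.update_eq_self] at h1
    rw [h1]
    exact mul_le_one' (h.tsum_weight_le_one h0 n) (PMF.coe_le_one _ _)

end Memory

section Measure

variable [Countable S] [MeasurableSpace S] [DiscreteMeasurableSpace S]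

open Classical in
/-- For a strategy with memory, probabilities may be bounded by superharmonic functionals that
also depend on the memory mode. -/
theorem Memory.Implements.prob_le_of_superharmonic {M : MDP S} {Q : Type} {τ : M.Memory Q}
    {σ : M.Strategy} {s₀ : S} (h : τ.Implements s₀ σ)
    (Φ : ℕ → (ℕ → S) → Q → ℝ≥0∞) (hΦ : Adapted Φ)
    (hs : ∀ n ρ m, ∑' p : Q × S,
      τ.step m (ρ n) p * Φ (n + 1) (Function.update ρ (n + 1) p.2) p.1 ≤ Φ n ρ m)
    (n : ℕ) (E : Set (ℕ → S)) (hE : ∀ ρ ∈ E, ∀ m, 1 ≤ Φ n ρ m) :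
    σ.prob s₀ E ≤ Φ 0 (fun _ => s₀) τ.init := by
  let W : ℕ → (ℕ → S) → ℝ≥0∞ := fun n ρ => ∑' m, τ.weight ρ n m
  -- This is the conditional expectation of `Φ` over the modes given the history. The value `⊤` on
  -- null histories makes the inequality trivial there, and a null successor contributes nothing
  -- because its weight `0` enters as a factor.
  let F : ℕ → (ℕ → S) → ℝ≥0∞ := fun n ρ =>
    if W n ρ = 0 then ⊤ else (∑' m, τ.weight ρ n m * Φ n ρ m) / W n ρ
  have hF : Adapted F := fun n ρ ρ' hρ => by
    simp only [F, W, τ.weight_congr hρ, hΦ n ρ ρ' hρ]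
  have h0 : F 0 (fun _ => s₀) = Φ 0 (fun _ => s₀) τ.init := by
    have hW : W 0 (fun _ => s₀) = 1 := by simp [W, Memory.weight]
    simp only [F, hW, one_ne_zero, if_false, div_one]
    rw [tsum_eq_single τ.init]
    · simp [Memory.weight]
    · intro m hm
      simp [Memory.weight, hm]
  rw [← h0]
  refine σ.prob_le_of_superharmonic s₀ F hF (fun n ρ hp => ?_) n E fun ρ hρ hp => ?_
  · by_cases hW : W n ρ = 0
    · simp [F, hW]
    have hWt : W n ρ ≠ ⊤ := ne_top_of_le_ne_top ENNReal.one_ne_top (h.tsum_weight_le_one hp.1 n)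
    have hFn : F n ρ = (∑' m, τ.weight ρ n m * Φ n ρ m) / W n ρ := if_neg hW
    rw [hFn, ENNReal.le_div_iff_mul_le (Or.inl hW) (Or.inl hWt), mul_comm, ← ENNReal.tsum_mul_left]
    have hterm : ∀ s, W n ρ * (σ.next n (histOf ρ n) s *
        F (n + 1) (Function.update ρ (n + 1) s)) ≤
        ∑' m, ∑' m₀, τ.weight ρ n m₀ * (τ.step m₀ (ρ n) (m, s) *
          Φ (n + 1) (Function.update ρ (n + 1) s) m) := by
      intro s
      have h1 : W (n + 1) (Function.update ρ (n + 1) s) = W n ρ * σ.next n (histOf ρ n) s :=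
        h.tsum_weight_succ hp.1 n s
      rw [← mul_assoc, ← h1]
      by_cases hW' : W (n + 1) (Function.update ρ (n + 1) s) = 0
      · rw [hW', zero_mul]; exact zero_le
      · have h2 : F (n + 1) (Function.update ρ (n + 1) s) = _ := if_neg hW'
        rw [h2]
        refine ENNReal.mul_div_le.trans (le_of_eq (tsum_congr fun m => ?_))
        rw [τ.weight_succ_update, ← ENNReal.tsum_mul_right]
        exact tsum_congr fun m₀ => mul_assoc _ _ _
    calc _ ≤ ∑' s, ∑' m, ∑' m₀, τ.weight ρ n m₀ * (τ.step m₀ (ρ n) (m, s) *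
          Φ (n + 1) (Function.update ρ (n + 1) s) m) := ENNReal.tsum_le_tsum hterm
      _ = ∑' m₀, τ.weight ρ n m₀ * ∑' p : Q × S,
            τ.step m₀ (ρ n) p * Φ (n + 1) (Function.update ρ (n + 1) p.2) p.1 := by
          rw [ENNReal.tsum_comm]
          rw [← ENNReal.tsum_prod (f := fun m s => ∑' m₀, τ.weight ρ n m₀ * (τ.step m₀ (ρ n) (m, s) *
            Φ (n + 1) (Function.update ρ (n + 1) s) m)), ENNReal.tsum_comm]
          exact tsum_congr fun m₀ => ENNReal.tsum_mul_left
      _ ≤ _ := ENNReal.tsum_le_tsum fun m₀ => by gcongr; exact hs n ρ m₀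
  · by_cases hW : W n ρ = 0
    · simp [F, hW]
    have hWt : W n ρ ≠ ⊤ :=
      ne_top_of_le_ne_top ENNReal.one_ne_top (h.tsum_weight_le_one (hp n).1 n)
    have hFn : F n ρ = (∑' m, τ.weight ρ n m * Φ n ρ m) / W n ρ := if_neg hW
    rw [hFn, ENNReal.le_div_iff_mul_le (Or.inl hW) (Or.inl hWt), one_mul]
    exact ENNReal.tsum_le_tsum fun m => le_mul_of_one_le_right' (hE ρ hρ m)

end Measure

/-! ### Safety probabilities -/

section Safety

variable {M : MDP S} {Q : Type}

open Classical in
/-- The probability that, in the chain on modes and states started at time `t` in mode `m` and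
state `s`, the next `l` states are all admissible. -/
noncomputable def Memory.safeFor (τ : M.Memory Q) (ok : ℕ → S → Prop) :
    ℕ → ℕ → Q → S → ℝ≥0∞
  | 0, _, _, _ => 1
  | l + 1, t, m, s =>
    ∑' p : Q × S, τ.step m s p * if ok (t + 1) p.2 then τ.safeFor ok l (t + 1) p.1 p.2 else 0

/-- The probability that all later states are admissible. -/
noncomputable def Memory.safe (τ : M.Memory Q) (ok : ℕ → S → Prop) (t : ℕ) (m : Q) (s : S) :
    ℝ≥0∞ :=
  ⨅ l, τ.safeFor ok l t m s

theorem Memory.safeFor_le_one (τ : M.Memory Q) (ok : ℕ → S → Prop) :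
    ∀ l t m s, τ.safeFor ok l t m s ≤ 1
  | 0, _, _, _ => le_rfl
  | l + 1, t, m, s => by
    rw [Memory.safeFor]
    calc _ ≤ ∑' p : Q × S, τ.step m s p * 1 := by
          refine ENNReal.tsum_le_tsum fun p => ?_
          gcongr
          split_ifs
          · exact τ.safeFor_le_one ok l _ _ _
          · exact zero_le
      _ = 1 := by simp [PMF.tsum_coe]

theorem Memory.safe_le_one (τ : M.Memory Q) (ok : ℕ → S → Prop) (t : ℕ) (m : Q) (s : S) :
    τ.safe ok t m s ≤ 1 :=
  iInf_le_of_le 0 le_rfl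

theorem Memory.safeFor_succ_le (τ : M.Memory Q) (ok : ℕ → S → Prop) :
    ∀ l t m s, τ.safeFor ok (l + 1) t m s ≤ τ.safeFor ok l t m s
  | 0, _, _, _ => τ.safeFor_le_one ok _ _ _ _
  | l + 1, t, m, s => by
    rw [Memory.safeFor, Memory.safeFor]
    refine ENNReal.tsum_le_tsum fun p => ?_
    gcongr
    split_ifs
    · exact τ.safeFor_succ_le ok l _ _ _
    · exact le_rfl

theorem tsum_iInf_of_antitone {α : Type*} (f : ℕ → α → ℝ≥0∞) (hf : Antitone f)
    (h0 : ∑' a, f 0 a ≠ ⊤) : ∑' a, ⨅ n, f n a = ⨅ n, ∑' a, f n a := by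
  let _ : MeasurableSpace α := ⊤
  have := lintegral_iInf (μ := Measure.count) (f := f) (fun n => measurable_from_top) hf
    (by rwa [lintegral_count])
  simpa only [lintegral_count] using this

open Classical in
-- The recursion for finite horizons passes to the infimum by monotone convergence for decreasing
-- sequences, which applies as the sums are at most `1`.
theorem Memory.safe_le (τ : M.Memory Q) (ok : ℕ → S → Prop) (t : ℕ) (m : Q) (s : S) :
    τ.safe ok t m s ≤
      ∑' p : Q × S, τ.step m s p * if ok (t + 1) p.2 then τ.safe ok (t + 1) p.1 p.2 else 0 := by
  have h1 : ∀ p : Q × S, (τ.step m s p * if ok (t + 1) p.2 then τ.safe ok (t + 1) p.1 p.2 else 0) =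
      ⨅ l, τ.step m s p * if ok (t + 1) p.2 then τ.safeFor ok l (t + 1) p.1 p.2 else 0 := by
    intro p
    split_ifs
    · exact ENNReal.mul_iInf fun h => absurd h (PMF.apply_ne_top _ _)
    · simp
  simp only [h1]
  rw [tsum_iInf_of_antitone]
  · exact le_iInf fun l => iInf_le_of_le (l + 1) (le_of_eq (by rw [Memory.safeFor]))
  · refine antitone_nat_of_succ_le fun l p => ?_
    dsimp only
    gcongr
    split_ifs
    · exact τ.safeFor_succ_le ok l _ _ _
    · exact le_rfl
  · refine ne_top_of_le_ne_top ENNReal.one_ne_top ?_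
    exact τ.safeFor_le_one ok 1 t m s

/-- For a fixed horizon `l`, the probability of staying safe for the remaining `l - n` steps, set to
`0` after a violation, is superharmonic. -/
theorem Memory.Implements.prob_safe_le [Countable S] [MeasurableSpace S]
    [DiscreteMeasurableSpace S] {τ : M.Memory Q} {σ : M.Strategy} {s₀ : S}
    (h : τ.Implements s₀ σ) (ok : ℕ → S → Prop) :
    σ.prob s₀ {ρ | ∀ t, ok t (ρ t)} ≤ τ.safe ok 0 τ.init s₀ := by
  classical
  refine le_iInf fun l => ?_
  let Φ : ℕ → (ℕ → S) → Q → ℝ≥0∞ := fun n ρ m =>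
    if ∀ t ≤ n, ok t (ρ t) then τ.safeFor ok (l - n) n m (ρ n) else 0
  have hcongr : ∀ n (ρ ρ' : ℕ → S), (∀ i ≤ n, ρ i = ρ' i) →
      ((∀ t ≤ n, ok t (ρ t)) ↔ ∀ t ≤ n, ok t (ρ' t)) := fun n ρ ρ' hρ =>
    forall₂_congr fun t ht => by rw [hρ t ht]
  have hΦ : Adapted Φ := fun n ρ ρ' hρ => by
    funext m
    simp only [Φ, hcongr n ρ ρ' hρ, hρ n le_rfl]
  refine (h.prob_le_of_superharmonic Φ hΦ (fun n ρ m => ?_) l _ fun ρ hρ m => ?_).trans ?_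
  · by_cases hok : ∀ t ≤ n, ok t (ρ t)
    · have h1 : Φ n ρ m = τ.safeFor ok (l - n) n m (ρ n) := if_pos hok
      have h2 : ∀ p : Q × S, Φ (n + 1) (Function.update ρ (n + 1) p.2) p.1 ≤
          if ok (n + 1) p.2 then τ.safeFor ok (l - (n + 1)) (n + 1) p.1 p.2 else 0 := by
        intro p
        simp only [Φ, Function.update_self]
        split_ifs with ha hb
        · exact le_rfl
        · have := ha (n + 1) le_rfl
          rw [Function.update_self] at this
          exact absurd this hb
        · exact zero_le
        · exact le_rfl
      rw [h1]
      refine (ENNReal.tsum_le_tsum fun p => mul_le_mul_right (h2 p) _).trans ?_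
      rcases Nat.lt_or_ge n l with hlt | hge
      · obtain ⟨d, hd⟩ : ∃ d, l - n = d + 1 := ⟨l - n - 1, by omega⟩
        have hd' : l - (n + 1) = d := by omega
        rw [hd, hd', Memory.safeFor]
      -- Past the horizon the truncated difference is `0`, and the functional is `1` as long as no
      -- violation has occurred.
      · have hd : l - n = 0 := by omega
        rw [hd]
        exact τ.safeFor_le_one ok (l - (n + 1) + 1) n m (ρ n)
    · refine le_of_eq_of_le (ENNReal.tsum_eq_zero.2 fun p => ?_) zero_le
      have : Φ (n + 1) (Function.update ρ (n + 1) p.2) p.1 = 0 := if_neg fun hc => hok fun t ht => by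
        have := hc t (ht.trans (Nat.le_succ n))
        rwa [update_eq_of_le ρ n p.2 ht] at this
      rw [this, mul_zero]
  · have : Φ l ρ m = τ.safeFor ok (l - l) l m (ρ l) := if_pos fun t _ => hρ t
    rw [this, Nat.sub_self]
    exact le_rfl
  · simp only [Φ]
    split_ifs
    · exact le_rfl
    · exact zero_le

end Safety

/-! ### Elimination of the reward counter -/

section RewardCounter

variable {M : MDP S} {F : Type}

/-- If the reward of a transition is the increase of a potential `R` of the states, the counter
can be recovered from the current state. -/
noncomputable def Memory.dropCounter (τ : M.Memory (F × ℝ)) (R : S → ℝ) : M.Memory F where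
  init := τ.init.1
  step f s := (τ.step (f, R s) s).map fun p => (p.1.1, p.2)
  step_ctrl f s hs p hp := by
    rw [PMF.support_map] at hp
    obtain ⟨q, hq, rfl⟩ := hp
    exact τ.step_ctrl _ s hs q hq
  step_rand f s hs := by
    rw [PMF.map_comp, ← τ.step_rand (f, R s) s hs]
    rfl

theorem Memory.HasRewardCounter.step_eq {τ : M.Memory (F × ℝ)} (h : τ.HasRewardCounter)
    {R : S → ℝ} (hR : ∀ s s', M.reward s s' = R s' - R s) (f f' : F) (s s' : S) (x : ℝ)
    [Decidable (x = R s')] :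
    τ.step (f, R s) s ((f', x), s') =
      if x = R s' then (τ.dropCounter R).step f s (f', s') else 0 := by
  classical
  have h0 : ∀ f' s' x, x ≠ R s' → τ.step (f, R s) s ((f', x), s') = 0 := by
    intro f' s' x hx
    by_contra hc
    refine hx ((h.2 f (R s) s _ hc).trans ?_)
    rw [hR]; ring
  split_ifs with hx
  · subst hx
    change _ = (PMF.map _ _) _
    rw [PMF.map_apply, tsum_eq_single ((f', R s'), s')]
    · simp
    · rintro ⟨⟨g, y⟩, u⟩ hne
      split_ifs with he
      · simp only [Prod.mk.injEq] at he
        obtain ⟨rfl, rfl⟩ := he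
        refine h0 _ _ _ fun hy => hne (by rw [hy])
      · rfl
  · exact h0 _ _ _ hx

theorem tsum_prod_ite_eq {α β : Type*} (y : β) (g : α → β → ℝ≥0∞) [DecidableEq β] :
    ∑' p : α × β, (if p.2 = y then g p.1 p.2 else 0) = ∑' a, g a y := by
  rw [ENNReal.tsum_prod']
  exact tsum_congr fun a => by simp

open Classical in
-- Along every history the counter is concentrated on the potential of the current state, so the sum
-- over counter values has a single term.
theorem Memory.HasRewardCounter.weight_eq {τ : M.Memory (F × ℝ)} (h : τ.HasRewardCounter)
    {R : S → ℝ} (hR : ∀ s s', M.reward s s' = R s' - R s) {s₀ : S} (hR0 : R s₀ = 0)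
    {ρ : ℕ → S} (h0 : ρ 0 = s₀) : ∀ (n : ℕ) (p : F × ℝ), τ.weight ρ n p =
      if p.2 = R (ρ n) then (τ.dropCounter R).weight ρ n p.1 else 0
  | 0, (f, x) => by
    simp only [Memory.weight, h0, hR0]
    have h1 : τ.init = ((τ.dropCounter R).init, 0) := Prod.ext rfl h.1
    rw [h1]
    by_cases hx : x = 0 <;> simp [hx]
  | n + 1, (f, x) => by
    simp only [Memory.weight, h.weight_eq hR hR0 h0 n, ite_mul, zero_mul]
    rw [tsum_prod_ite_eq (R (ρ n)) fun a b =>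
      (τ.dropCounter R).weight ρ n a * τ.step (a, b) (ρ n) ((f, x), ρ (n + 1))]
    simp only [h.step_eq hR]
    split_ifs <;> simp

theorem Memory.HasRewardCounter.implements_dropCounter {τ : M.Memory (F × ℝ)}
    (h : τ.HasRewardCounter) {R : S → ℝ} (hR : ∀ s s', M.reward s s' = R s' - R s) {s₀ : S}
    (hR0 : R s₀ = 0) {σ : M.Strategy} (hσ : τ.Implements s₀ σ) :
    (τ.dropCounter R).Implements s₀ σ := by
  classical
  intro ρ n h0 hc s'
  have h1 := hσ ρ n h0 hc s'
  simp only [h.weight_eq hR hR0 h0, ite_mul, zero_mul] at h1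
  rw [tsum_prod_ite_eq (R (ρ n)) fun a _ => (τ.dropCounter R).weight ρ n a,
    tsum_prod_ite_eq (R (ρ n)) fun a b =>
      (τ.dropCounter R).weight ρ n a * ∑' m' : F × ℝ, τ.step (a, b) (ρ n) (m', s')] at h1
  rw [h1]
  refine tsum_congr fun f => congrArg _ ?_
  have h2 : ∀ m' : F × ℝ, τ.step (f, R (ρ n)) (ρ n) (m', s') =
      if m'.2 = R s' then (τ.dropCounter R).step f (ρ n) (m'.1, s') else 0 :=
    fun m' => h.step_eq hR f m'.1 (ρ n) s' m'.2
  simp only [h2]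
  exact tsum_prod_ite_eq (R s') fun a _ => (τ.dropCounter R).step f (ρ n) (a, s')

end RewardCounter

theorem Strategy.FiniteMemoryRewardCounter.finiteMemory {M : MDP S} {R : S → ℝ}
    (hR : ∀ s s', M.reward s s' = R s' - R s) {s₀ : S} (hR0 : R s₀ = 0) {σ : M.Strategy}
    (h : σ.FiniteMemoryRewardCounter s₀) : σ.FiniteMemory s₀ := by
  obtain ⟨F, hF, τ, hτ, hσ⟩ := h
  exact ⟨F, hF, τ.dropCounter R, hτ.implements_dropCounter hR hR0 hσ⟩

theorem totalReward_eq_of_potential {M : MDP S} {R : S → ℝ}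
    (hR : ∀ s s', M.reward s s' = R s' - R s) (ρ : ℕ → S) (n : ℕ) :
    M.totalReward ρ n = R (ρ n) - R (ρ 0) := by
  simp only [totalReward, hR]
  exact Finset.sum_range_sub (fun i => R (ρ i)) n

end MDP

/-! ### The ladder and its parameters -/

/-- The states of the ladder.  In `wait n c` there are `c` time units left to wait for the decision
of stage `n`, in `bet n j` the number `j` has been chosen, and `dip n j` has a negative total
reward, which is made up for on entering stage `n + 1`. -/
inductive LadderState : Type
  | wait (n c : ℕ)
  | bet (n j : ℕ)
  | dip (n j : ℕ)

namespace LadderState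

instance : Countable LadderState := by
  let f : LadderState → ℕ × ℕ × ℕ
    | wait n c => (0, n, c)
    | bet n j => (1, n, j)
    | dip n j => (2, n, j)
  refine Function.Injective.countable (f := f) ?_
  rintro (⟨n, c⟩ | ⟨n, c⟩ | ⟨n, c⟩) (⟨n', c'⟩ | ⟨n', c'⟩ | ⟨n', c'⟩) h <;> simp_all [f]

instance : MeasurableSpace LadderState := ⊤

instance : DiscreteMeasurableSpace LadderState := ⟨fun _ => trivial⟩

end LadderState

namespace Ladder

open LadderState

section Parameters

/-- The ratio of the probabilities of successive delays. -/
def ratio (k : ℕ) : ℕ := (k + 1) * 2 ^ (k + 1)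

/-- The normalization of the probabilities of the delays. -/
def norm (k : ℕ) : ℕ := ∑ i ∈ range (k + 1), ratio k ^ i

theorem ratio_pos (k : ℕ) : 0 < ratio k := by unfold ratio; positivity

theorem norm_pos (k : ℕ) : 0 < norm k :=
  Finset.sum_pos (fun i _ => pow_pos (ratio_pos k) i) ⟨0, by simp⟩

/-- The probability of the `i`-th delay. -/
noncomputable def delayProb (k i : ℕ) : ℝ≥0∞ :=
  if i ≤ k then ((ratio k ^ i : ℕ) : ℝ≥0∞) * ((norm k : ℕ) : ℝ≥0∞)⁻¹ else 0

/-- The risk of choosing the number `j`. -/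
noncomputable def risk (k j : ℕ) : ℝ≥0∞ := ((ratio k ^ (j + 1) : ℕ) : ℝ≥0∞)⁻¹

theorem risk_le_one (k j : ℕ) : risk k j ≤ 1 := by
  unfold risk
  rw [ENNReal.inv_le_one]
  exact_mod_cast Nat.one_le_pow _ _ (ratio_pos k)

theorem risk_anti (k : ℕ) {i j : ℕ} (h : i ≤ j) : risk k j ≤ risk k i := by
  unfold risk
  rw [ENNReal.inv_le_inv]
  exact_mod_cast Nat.pow_le_pow_right (ratio_pos k) (by omega)

theorem sum_delayProb (k : ℕ) : ∑ i ∈ range (k + 1), delayProb k i = 1 := by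
  have h : ∀ i ∈ range (k + 1), delayProb k i =
      ((ratio k ^ i : ℕ) : ℝ≥0∞) * ((norm k : ℕ) : ℝ≥0∞)⁻¹ := fun i hi =>
    if_pos (Nat.lt_succ_iff.1 (Finset.mem_range.1 hi))
  rw [Finset.sum_congr rfl h, ← Finset.sum_mul, ← Nat.cast_sum]
  exact ENNReal.mul_inv_cancel (by exact_mod_cast (norm_pos k).ne') (ENNReal.natCast_ne_top _)

theorem inv_norm_le_delayProb {k i : ℕ} (hi : i ≤ k) :
    ((norm k : ℕ) : ℝ≥0∞)⁻¹ ≤ delayProb k i := by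
  rw [delayProb, if_pos hi]
  refine le_mul_of_one_le_left' ?_
  exact_mod_cast Nat.one_le_pow _ _ (ratio_pos k)

/-- The quotient of the two powers is `ratio k ^ (i' - i - 1) ≥ 1`: a number that is safe for index
`i` is too risky for any larger index. -/
theorem inv_norm_le_delayProb_mul_risk {k i i' : ℕ} (hi : i < i') (hk : i' ≤ k) :
    ((norm k : ℕ) : ℝ≥0∞)⁻¹ ≤ delayProb k i' * risk k i := by
  rw [delayProb, if_pos hk, mul_right_comm]
  refine le_mul_of_one_le_left' ?_
  rw [risk, ← div_eq_mul_inv, ENNReal.le_div_iff_mul_le (Or.inl ?_)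
    (Or.inl (ENNReal.natCast_ne_top _)), one_mul]
  · exact_mod_cast Nat.pow_le_pow_right (ratio_pos k) hi
  · exact_mod_cast (pow_pos (ratio_pos k) _).ne'

/-- For the matching number the powers cancel and a factor `1 / ratio k` is gained, whatever the
index. -/
theorem delayProb_mul_risk {k i : ℕ} (hi : i ≤ k) :
    delayProb k i * risk k i = ((norm k : ℕ) : ℝ≥0∞)⁻¹ * ((ratio k : ℕ) : ℝ≥0∞)⁻¹ := by
  have h1 : ((ratio k ^ i : ℕ) : ℝ≥0∞) ≠ 0 := by exact_mod_cast (pow_pos (ratio_pos k) _).ne'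
  rw [delayProb, if_pos hi, risk, pow_succ, Nat.cast_mul,
    ENNReal.mul_inv (Or.inl h1) (Or.inl (ENNReal.natCast_ne_top _)), mul_right_comm, ← mul_assoc,
    ENNReal.mul_inv_cancel h1 (ENNReal.natCast_ne_top _), one_mul, mul_comm]

/-- The law of the index of the delay. -/
noncomputable def delayIndex (k : ℕ) : PMF ℕ :=
  PMF.ofFinset (delayProb k) (range (k + 1)) (sum_delayProb k) fun _ hi =>
    if_neg fun h => hi (Finset.mem_range.2 (Nat.lt_succ_iff.2 h))

/-- The coin that decides whether a risk is realized. -/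
noncomputable def riskCoin (k j : ℕ) : PMF Bool :=
  PMF.ofFintype (fun b => cond b (risk k j) (1 - risk k j)) (by
    simp [add_tsub_cancel_of_le (risk_le_one k j)])

end Parameters

variable (e : ℕ → ℕ)

/-- The number of dips in the stages before stage `n`. -/
def base (n : ℕ) : ℕ := ∑ l ∈ range n, (e l + 2)

/-- The depth of the `j`-th dip of stage `n`. -/
def depth (n j : ℕ) : ℕ := (base e n + j + 3).factorial

/-- The `i`-th delay of stage `n`. -/
def delay (n i : ℕ) : ℕ := n * depth e n i

theorem le_base (n : ℕ) : n ≤ base e n := by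
  have : ∑ l ∈ range n, 1 ≤ ∑ l ∈ range n, (e l + 2) := Finset.sum_le_sum fun i _ => by omega
  simpa [base] using this

theorem depth_mono (n : ℕ) {i j : ℕ} (h : i ≤ j) : depth e n i ≤ depth e n j :=
  Nat.factorial_le (by omega)

/-- `base` counts `e n + 2` dips per stage, the top dip included, so the depths run through
consecutive factorials across stages. -/
theorem depth_succ_zero (n : ℕ) : depth e (n + 1) 0 = depth e n (e n + 2) := by
  simp only [depth, base, Finset.sum_range_succ, add_zero, add_assoc]

theorem depth_zero_mono {n m : ℕ} (h : n ≤ m) : depth e n 0 ≤ depth e m 0 := by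
  refine monotone_nat_of_le_succ (f := fun n => depth e n 0) (fun n => ?_) h
  simp only [depth_succ_zero]
  exact depth_mono e n (Nat.zero_le _)

theorem one_le_depth (n j : ℕ) : 1 ≤ depth e n j := Nat.factorial_pos _

/-- The next depth is at least `n + 4` times `depth e n i`. Of these copies, `n` make up the delay,
one bounds `depth e n 0`, and the other three absorb the constant. -/
theorem depth_zero_add_delay_lt (n : ℕ) {i j : ℕ} (h : i < j) :
    depth e n 0 + delay e n i + 3 ≤ depth e n j := by
  refine le_trans ?_ (depth_mono e n h)
  have h1 : depth e n (i + 1) = (base e n + i + 4) * depth e n i := Nat.factorial_succ _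
  have h2 := le_base e n
  have h3 := depth_mono e n (Nat.zero_le i)
  have h4 := one_le_depth e n i
  rw [h1, delay]
  nlinarith [Nat.mul_le_mul_right (depth e n i) (show n + 4 ≤ base e n + i + 4 by omega)]

/-- Stage `n` is entered by time `depth e n 0`, so the possible decision times for different indices
lie in disjoint windows. In stage `0` all delays vanish. -/
theorem depth_zero_add_delay_lt_delay {n : ℕ} (hn : 1 ≤ n) {i j : ℕ} (h : i < j) :
    depth e n 0 + delay e n i < delay e n j := by
  have h1 := depth_zero_add_delay_lt e n h
  have h2 : depth e n j ≤ delay e n j := Nat.le_mul_of_pos_left _ hn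
  omega

theorem depth_zero_add_delay_le_next (n : ℕ) {i : ℕ} (h : i ≤ e n) :
    depth e n 0 + delay e n i + 3 ≤ depth e (n + 1) 0 := by
  rw [depth_succ_zero]
  exact depth_zero_add_delay_lt e n (by omega)

theorem delay_injective {n : ℕ} (hn : 1 ≤ n) : Function.Injective (delay e n) := by
  refine (strictMono_nat_of_lt_succ fun i => ?_).injective
  exact (Nat.le_add_left _ _).trans_lt (depth_zero_add_delay_lt_delay e hn (Nat.lt_succ_self i))

theorem le_delay (n i : ℕ) : n ≤ delay e n i := Nat.le_mul_of_pos_right _ (one_le_depth e n i)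

open Classical in
/-- The successors of a state. -/
noncomputable def succs : LadderState → Finset LadderState
  | wait n 0 => (range (e n + 1)).image (bet n)
  | wait n (c + 1) => {wait n c}
  | bet n j => {dip n j, dip n (e n + 1)}
  | dip n _ => (range (e (n + 1) + 1)).image fun i => wait (n + 1) (delay e (n + 1) i)

/-- The total reward as a function of the state. -/
noncomputable def potential : LadderState → ℝ
  | dip n j => -(depth e n j : ℝ)
  | _ => 0

/-- The transition probabilities. -/
noncomputable def stepProb : LadderState → PMF LadderState
  | wait n c => PMF.pure (wait n (c - 1))
  | bet n j => (riskCoin (e n) j).map fun b => cond b (dip n (e n + 1)) (dip n j)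
  | dip n _ => (delayIndex (e (n + 1))).map fun i => wait (n + 1) (delay e (n + 1) i)

/-- In stage `n` a random delay is drawn, of which only the elapsed time tells the index; a number
at most `e n` is then chosen.  A number above the index of the delay, and, independently, a
realized risk, lead to a dip that is deep relative to the elapsed time.  The risk decreases with
the number chosen. -/
noncomputable def mdp : MDP LadderState where
  ctrl := Set.range fun n => wait n 0
  trans s s' := s' ∈ succs e s
  prob := stepProb e
  reward s s' := potential e s' - potential e s
  exists_succ s := by
    rcases s with ⟨n, _ | c⟩ | ⟨n, j⟩ | ⟨n, j⟩
    · exact ⟨bet n 0, by simp [succs]⟩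
    · exact ⟨wait n c, by simp [succs]⟩
    · exact ⟨dip n j, by simp [succs]⟩
    · exact ⟨wait (n + 1) (delay e (n + 1) 0), by
        simp only [succs, mem_image, mem_range]; exact ⟨0, by omega, rfl⟩⟩
  prob_supp s hs s' hs' := by
    rcases s with ⟨n, _ | c⟩ | ⟨n, j⟩ | ⟨n, j⟩
    · exact absurd ⟨n, rfl⟩ hs
    · simpa [succs, stepProb] using hs'
    · simp only [stepProb, PMF.support_map, Set.mem_image] at hs'
      obtain ⟨b, -, rfl⟩ := hs'
      cases b <;> simp [succs]
    · simp only [stepProb, PMF.support_map, Set.mem_image] at hs'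
      obtain ⟨i, hi, rfl⟩ := hs'
      simp only [succs, mem_image]
      exact ⟨i, ((PMF.mem_support_ofFinset_iff _ _ _).1 hi).1, rfl⟩

theorem trans_wait_zero {n : ℕ} {s : LadderState} :
    (mdp e).trans (wait n 0) s ↔ ∃ j ≤ e n, bet n j = s := by
  simp [mdp, succs]

theorem trans_wait_succ {n c : ℕ} {s : LadderState} :
    (mdp e).trans (wait n (c + 1)) s ↔ s = wait n c := by
  simp [mdp, succs]

theorem trans_bet {n j : ℕ} {s : LadderState} :
    (mdp e).trans (bet n j) s ↔ s = dip n j ∨ s = dip n (e n + 1) := by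
  simp [mdp, succs]

theorem trans_dip {n j : ℕ} {s : LadderState} :
    (mdp e).trans (dip n j) s ↔ ∃ i ≤ e (n + 1), wait (n + 1) (delay e (n + 1) i) = s := by
  simp [mdp, succs]

theorem finitelyBranching : (mdp e).FinitelyBranching := fun s =>
  (succs e s).finite_toSet

/-- A rank that increases along transitions. -/
def rank : LadderState → ℕ ×ₗ ℤ
  | wait n c => toLex (n, -c)
  | bet n _ => toLex (n, 1)
  | dip n _ => toLex (n, 2)

theorem rank_lt {s s' : LadderState} (h : (mdp e).trans s s') : rank s < rank s' := by
  rcases s with ⟨n, _ | c⟩ | ⟨n, j⟩ | ⟨n, j⟩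
  · obtain ⟨j, -, rfl⟩ := (trans_wait_zero e).1 h
    simp [rank, Prod.Lex.toLex_lt_toLex]
  · obtain rfl := (trans_wait_succ e).1 h
    simp [rank, Prod.Lex.toLex_lt_toLex]
  · obtain rfl | rfl := (trans_bet e).1 h <;> simp [rank, Prod.Lex.toLex_lt_toLex]
  · obtain ⟨i, -, rfl⟩ := (trans_dip e).1 h
    simp [rank, Prod.Lex.toLex_lt_toLex]

theorem acyclic : (mdp e).Acyclic := by
  intro s h
  have : ∀ s', Relation.TransGen (mdp e).trans s s' → rank s < rank s' := by
    intro s' h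
    induction h with
    | single h => exact rank_lt e h
    | tail _ h ih => exact ih.trans (rank_lt e h)
  exact lt_irrefl _ (this s h)

theorem reward_eq (s s' : LadderState) :
    (mdp e).reward s s' = potential e s' - potential e s := rfl

theorem rewardImplicit : (mdp e).RewardImplicit (wait 0 0) :=
  ⟨potential e, fun ρ n h0 _ => by
    rw [MDP.totalReward_eq_of_potential (reward_eq e), h0]; simp [potential]⟩

theorem prob_bet_dip {n j : ℕ} (hj : j ≤ e n) :
    (mdp e).prob (bet n j) (dip n j) = 1 - risk (e n) j := by
  have h : (j = e n + 1) = False := by simp; omega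
  change PMF.map _ _ _ = _
  simp [PMF.map_apply, riskCoin, h]

/-! ### Reachable times and the mean payoff of a run -/

/-- The times at which a state can be visited. -/
def Reachable (t : ℕ) : LadderState → Prop
  | wait n c => ∃ i ≤ e n, delay e n i ≤ t + c ∧ t + c ≤ depth e n 0 + delay e n i
  | bet n j => j ≤ e n ∧ ∃ i ≤ e n, delay e n i + 1 ≤ t ∧ t ≤ depth e n 0 + delay e n i + 1
  | dip n j => j ≤ e n + 1 ∧ ∃ i ≤ e n, delay e n i + 2 ≤ t ∧ t ≤ depth e n 0 + delay e n i + 2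

theorem Reachable.succ {t : ℕ} {s s' : LadderState} (h : Reachable e t s)
    (ht : (mdp e).trans s s') : Reachable e (t + 1) s' := by
  rcases s with ⟨n, _ | c⟩ | ⟨n, j⟩ | ⟨n, j⟩
  · obtain ⟨j, hj, rfl⟩ := (trans_wait_zero e).1 ht
    obtain ⟨i, hi, h1, h2⟩ := h
    exact ⟨hj, i, hi, by omega, by omega⟩
  · obtain rfl := (trans_wait_succ e).1 ht
    obtain ⟨i, hi, h1, h2⟩ := h
    exact ⟨i, hi, by omega, by omega⟩
  · obtain ⟨hj, i, hi, h1, h2⟩ := h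
    obtain rfl | rfl := (trans_bet e).1 ht <;> exact ⟨by omega, i, hi, by omega, by omega⟩
  · obtain ⟨hj, i, hi, h1, h2⟩ := h
    obtain ⟨i', hi', rfl⟩ := (trans_dip e).1 ht
    have := depth_zero_add_delay_le_next e n hi
    exact ⟨i', hi', by omega, by omega⟩

theorem reachable_of_isPath {ρ : ℕ → LadderState} :
    ∀ {n : ℕ}, (mdp e).IsPath (wait 0 0) n ρ → Reachable e n (ρ n)
  | 0, h => by
    rw [h.1]
    exact ⟨0, Nat.zero_le _, by simp [delay], by simp⟩
  | n + 1, h =>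
    (reachable_of_isPath ⟨h.1, fun i hi => h.2 i (by omega)⟩).succ e (h.2 n (Nat.lt_succ_self n))

theorem meanPayoff_iff {ρ : ℕ → LadderState} (h0 : ρ 0 = wait 0 0) :
    ρ ∈ (mdp e).meanPayoff ↔ 0 ≤ Filter.liminf
      (fun n : ℕ => ((potential e (ρ n) / n : ℝ) : EReal)) Filter.atTop := by
  have : ∀ n, (mdp e).totalReward ρ n = potential e (ρ n) := fun n => by
    rw [MDP.totalReward_eq_of_potential (reward_eq e), h0]; simp [potential]
  simp only [MDP.meanPayoff, Set.mem_ofPred_eq, this]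

/-- At each such dip the mean payoff is at most `-1`. These times are unbounded, since a dip of
stage `n` cannot be reached before time `n`. -/
theorem notMem_meanPayoff {ρ : ℕ → LadderState} (hρ : ∀ n, (mdp e).IsPath (wait 0 0) n ρ)
    (h : ∀ N, ∃ t n j, ρ t = dip n j ∧ N ≤ n ∧ t ≤ depth e n j) : ρ ∉ (mdp e).meanPayoff := by
  rw [meanPayoff_iff e (hρ 0).1, not_le]
  refine lt_of_le_of_lt (b := ((-1 : ℝ) : EReal)) ?_ (by exact_mod_cast neg_one_lt_zero)
  refine Filter.liminf_le_of_frequently_le' ?_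
  rw [Filter.frequently_atTop]
  intro N
  obtain ⟨t, n, j, ht, hn, hd⟩ := h (N + 1)
  have hr := reachable_of_isPath e (hρ t)
  rw [ht] at hr
  obtain ⟨-, i, -, h1, -⟩ := hr
  have h2 := le_delay e n i
  refine ⟨t, by omega, ?_⟩
  have ht0 : (0 : ℝ) < t := by exact_mod_cast (by omega : 0 < t)
  have hd' : (t : ℝ) ≤ depth e n j := by exact_mod_cast hd
  rw [ht]
  simp only [potential]
  rw [EReal.coe_le_coe_iff, div_le_iff₀ ht0]
  linarith

/-- A dip of stage `n` reached after its delay `n * depth e n j` lowers the mean payoff to no less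
than `-1 / n`, and late times belong to late stages. -/
theorem mem_meanPayoff {ρ : ℕ → LadderState} (hρ : ∀ n, (mdp e).IsPath (wait 0 0) n ρ)
    (h : ∃ N, ∀ t n j, ρ t = dip n j → N ≤ n → delay e n j ≤ t) : ρ ∈ (mdp e).meanPayoff := by
  rw [meanPayoff_iff e (hρ 0).1]
  obtain ⟨N, hN⟩ := h
  refine le_of_forall_lt_imp_le_of_dense fun c hc => ?_
  obtain ⟨y, hcy, hy⟩ := EReal.lt_iff_exists_real_btwn.1 hc
  have hy0 : y < 0 := by exact_mod_cast hy
  refine hcy.le.trans (Filter.le_liminf_of_le (by isBoundedDefault) ?_)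
  obtain ⟨K, hK⟩ := exists_nat_ge (1 / (-y))
  rw [div_le_iff₀ (by linarith)] at hK
  -- Stage `max K N` and all earlier ones are over by this time, so any dip visited later has stage
  -- `n ≥ K`, where `-1 / n ≥ y`.
  filter_upwards [Filter.eventually_gt_atTop (depth e (max K N + 1) 0)] with t ht
  have ht0 : (0 : ℝ) < t := by exact_mod_cast (Nat.zero_le _).trans_lt ht
  rw [EReal.coe_le_coe_iff, le_div_iff₀ ht0]
  have hr := reachable_of_isPath e (hρ t)
  rcases hs : ρ t with ⟨n, c⟩ | ⟨n, j⟩ | ⟨n, j⟩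
  · simp only [potential]; nlinarith
  · simp only [potential]; nlinarith
  · rw [hs] at hr
    obtain ⟨-, i, hi, -, h2⟩ := hr
    have h3 := depth_zero_add_delay_le_next e n hi
    have hn : max K N < n := by
      by_contra hle
      have := depth_zero_mono e (show n + 1 ≤ max K N + 1 by omega)
      omega
    have hd := hN t n j hs ((le_max_right K N).trans hn.le)
    have hKn : K ≤ n := (le_max_left K N).trans hn.le
    have h4 : (K : ℝ) * depth e n j ≤ t := by
      exact_mod_cast (Nat.mul_le_mul_right _ hKn).trans hd
    have h5 : (0 : ℝ) ≤ depth e n j := Nat.cast_nonneg _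
    simp only [potential]
    nlinarith [mul_le_mul_of_nonneg_left h4 (by linarith : 0 ≤ -y),
      mul_le_mul_of_nonneg_right hK h5]

end Ladder

/-! ### The matching strategy and the value -/

theorem PMF.tsum_map_mul {α β : Type*} (p : PMF α) (f : α → β) (g : β → ℝ≥0∞) :
    ∑' b, p.map f b * g b = ∑' a, p a * g (f a) := by
  classical
  simp only [PMF.map_apply, ← ENNReal.tsum_mul_right, ite_mul, zero_mul]
  rw [ENNReal.tsum_comm]
  refine tsum_congr fun a => ?_
  rw [tsum_eq_single (f a) fun b hb => if_neg hb, if_pos rfl]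

theorem PMF.tsum_pure_mul {α : Type*} (a : α) (g : α → ℝ≥0∞) :
    ∑' b, PMF.pure a b * g b = g a := by
  classical
  rw [tsum_eq_single a fun b hb => by rw [PMF.pure_apply_of_ne _ _ hb, zero_mul],
    PMF.pure_apply_self, one_mul]

namespace Ladder

open LadderState

variable (e : ℕ → ℕ)

/-- The largest number whose dip is harmless after the time `t`. -/
def pick (n t : ℕ) : ℕ := Nat.findGreatest (fun j => delay e n j ≤ t) (e n)

theorem pick_le (n t : ℕ) : pick e n t ≤ e n := Nat.findGreatest_le _

theorem delay_pick_le {n t i : ℕ} (hi : i ≤ e n) (h : delay e n i ≤ t) :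
    delay e n (pick e n t) ≤ t :=
  Nat.findGreatest_spec (P := fun j => delay e n j ≤ t) hi h

theorem pick_eq {n t i : ℕ} (hn : 1 ≤ n) (hi : i ≤ e n) (h : delay e n i ≤ t)
    (h' : t ≤ depth e n 0 + delay e n i) : pick e n t = i := by
  refine le_antisymm ?_ (Nat.le_findGreatest hi h)
  by_contra hlt
  have h1 := depth_zero_add_delay_lt_delay e hn (not_le.1 hlt)
  have h2 := delay_pick_le e hi h
  omega

/-- The strategy that chooses the number determined by the elapsed time. -/
noncomputable def matching : (mdp e).Strategy where
  act t h := PMF.pure (match h.last with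
    | wait n _ => bet n (pick e n t)
    | s => s)
  act_supp t h hc s hs := by
    obtain ⟨n, hn⟩ := hc
    rw [← hn] at hs ⊢
    simp only [PMF.support_pure, Set.mem_singleton_iff] at hs
    exact (trans_wait_zero e).2 ⟨_, pick_le e n t, hs.symm⟩

theorem matching_next_wait_zero {ρ : ℕ → LadderState} {t n : ℕ} (h : ρ t = wait n 0) :
    (matching e).next t (histOf ρ t) = PMF.pure (bet n (pick e n t)) := by
  have hl : Hist.last (histOf ρ t) = wait n 0 := h
  have hc : Hist.last (histOf ρ t) ∈ (mdp e).ctrl := ⟨n, hl.symm⟩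
  refine (if_pos hc).trans ?_
  simp only [matching, hl]

theorem next_of_notMem_ctrl (σ : (mdp e).Strategy) {ρ : ℕ → LadderState} {t : ℕ}
    (h : ρ t ∉ (mdp e).ctrl) : σ.next t (histOf ρ t) = stepProb e (ρ t) :=
  if_neg h

/-- The choice has been a number whose dip is harmless. -/
def Matched (t : ℕ) : LadderState → Prop
  | wait _ _ => True
  | bet n j => delay e n j ≤ t
  | dip n j => j ≤ e n → delay e n j ≤ t

theorem matched_of_isPlay {ρ : ℕ → LadderState} :
    ∀ {t : ℕ}, (matching e).IsPlay (wait 0 0) t ρ → Matched e t (ρ t)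
  | 0, h => by rw [h.1]; trivial
  | t + 1, h => by
    have hp : (matching e).IsPlay (wait 0 0) t ρ := ⟨h.1, fun i hi => h.2 i (by omega)⟩
    have ih := matched_of_isPlay hp
    have hr := reachable_of_isPath e hp.isPath
    have hn := h.2 t (Nat.lt_succ_self t)
    have ht := (matching e).trans_of_next_ne_zero hn
    rcases hs : ρ t with ⟨n, _ | c⟩ | ⟨n, j⟩ | ⟨n, j⟩
    · rw [matching_next_wait_zero e hs] at hn
      have : ρ (t + 1) = bet n (pick e n t) := by
        simpa [PMF.pure_apply] using hn
      rw [this]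
      rw [hs] at hr
      obtain ⟨i, hi, h1, -⟩ := hr
      exact (delay_pick_le e hi h1).trans (Nat.le_succ t)
    · rw [hs, trans_wait_succ] at ht
      rw [ht]; trivial
    · rw [hs] at ht ih
      obtain h1 | h1 := (trans_bet e).1 ht
      · rw [h1]
        exact fun _ => Nat.le_succ_of_le ih
      · rw [h1]
        exact fun hle => absurd hle (by omega)
    · rw [hs] at ht
      obtain ⟨i, -, h1⟩ := (trans_dip e).1 ht
      rw [← h1]; trivial

/-- The probability that the risk of a stage is realized under the strategy `matching`. -/
noncomputable def stageRisk (k : ℕ) : ℝ≥0∞ :=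
  (k + 1 : ℕ) * (((norm k : ℕ) : ℝ≥0∞)⁻¹ * ((ratio k : ℕ) : ℝ≥0∞)⁻¹)

theorem tsum_delayIndex_mul_risk (k : ℕ) : ∑' i, delayIndex k i * risk k i = stageRisk k := by
  have h : ∀ i, delayIndex k i = delayProb k i := fun _ => rfl
  simp only [h]
  rw [tsum_eq_sum (s := range (k + 1)) fun i hi => by
    rw [delayProb, if_neg fun h => hi (Finset.mem_range.2 (Nat.lt_succ_iff.2 h)), zero_mul],
    Finset.sum_congr rfl fun i hi => delayProb_mul_risk (Nat.lt_succ_iff.1 (Finset.mem_range.1 hi)),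
    Finset.sum_const, Finset.card_range, nsmul_eq_mul]
  rfl

/-- The conditional probability that the risk of stage `n` is realized under the strategy
`matching`, given the time and the current state. -/
noncomputable def riskAhead (n t : ℕ) : LadderState → ℝ≥0∞
  | wait m c => if m < n then stageRisk (e n) else if m = n then risk (e n) (pick e n (t + c)) else 0
  | bet m j => if m < n then stageRisk (e n) else if m = n then risk (e n) j else 0
  | dip m j => if m < n then stageRisk (e n) else if m = n ∧ j = e n + 1 then 1 else 0

/-- The decision time `t + c` is constant during a wait, so the only averaging happens on entering
stage `n`, where the chosen number is the drawn index, and at the bet. -/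
theorem tsum_next_mul_riskAhead_le {n : ℕ} {ρ : ℕ → LadderState} {t : ℕ}
    (h : (matching e).IsPlay (wait 0 0) t ρ) (hne : ρ t ≠ dip n (e n + 1)) :
    ∑' s, (matching e).next t (histOf ρ t) s * riskAhead e n (t + 1) s ≤ riskAhead e n t (ρ t) := by
  have hr := reachable_of_isPath e h.isPath
  rcases hs : ρ t with ⟨m, _ | c⟩ | ⟨m, j⟩ | ⟨m, j⟩
  · rw [matching_next_wait_zero e hs, PMF.tsum_pure_mul]
    simp only [riskAhead, add_zero]
    split_ifs <;> simp_all
  · rw [next_of_notMem_ctrl _ _ (by rw [hs]; rintro ⟨n, hn⟩; simp at hn), hs, stepProb,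
      PMF.tsum_pure_mul]
    simp only [riskAhead, add_tsub_cancel_right, show t + 1 + c = t + (c + 1) by omega]
    exact le_rfl
  · rw [next_of_notMem_ctrl _ _ (by rw [hs]; rintro ⟨n, hn⟩; simp at hn), hs, stepProb,
      PMF.tsum_map_mul]
    rw [hs] at hr
    have hj := hr.1
    rw [tsum_bool]
    rcases lt_trichotomy m n with hlt | rfl | hgt
    · simp only [cond_false, cond_true, riskAhead, if_pos hlt, ← add_mul]
      rw [← tsum_bool (fun b => riskCoin (e m) j b), PMF.tsum_coe, one_mul]
    · simp only [cond_false, cond_true, riskAhead, lt_irrefl, if_false, true_and, if_true]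
      rw [if_neg (by omega), mul_zero, zero_add, mul_one]
      exact le_rfl
    · have h1 : ¬ m < n := by omega
      have h2 : m ≠ n := by omega
      simp [riskAhead, h1, h2]
  · rw [next_of_notMem_ctrl _ _ (by rw [hs]; rintro ⟨n, hn⟩; simp at hn), hs, stepProb,
      PMF.tsum_map_mul]
    rw [hs] at hr hne
    obtain ⟨-, i₀, hi₀, -, h2⟩ := hr
    have h3 := depth_zero_add_delay_le_next e m hi₀
    rcases lt_trichotomy (m + 1) n with hlt | rfl | hgt
    · have h1 : m < n := by omega
      simp only [riskAhead, if_pos hlt, if_pos h1]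
      rw [ENNReal.tsum_mul_right, PMF.tsum_coe, one_mul]
    · simp only [riskAhead, lt_irrefl, if_false, if_true, Nat.lt_succ_self]
      rw [← tsum_delayIndex_mul_risk]
      refine ENNReal.tsum_le_tsum fun i => ?_
      by_cases hi : i ≤ e (m + 1)
      -- The stage is entered at time `t + 1 ≤ depth e (m + 1) 0`, so the decision time lies in the
      -- window of index `i`.
      · rw [pick_eq e (show 1 ≤ m + 1 by omega) hi (by omega) (by omega)]
      · have : delayIndex (e (m + 1)) i = 0 := if_neg hi
        rw [this, zero_mul]; exact zero_le
    · have h1 : ¬ m + 1 < n := by omega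
      have h2 : m + 1 ≠ n := by omega
      simp [riskAhead, h1, h2]

theorem prob_exists_le_eq_top_dip_le {n : ℕ} (hn : 1 ≤ n) (T : ℕ) :
    (matching e).prob (wait 0 0) {ρ | ∃ t ≤ T, ρ t = dip n (e n + 1)} ≤ stageRisk (e n) := by
  classical
  -- The functional is frozen at `1` once the top dip has been visited.
  let F : ℕ → (ℕ → LadderState) → ℝ≥0∞ := fun t ρ =>
    if ∃ u ≤ t, ρ u = dip n (e n + 1) then 1 else riskAhead e n t (ρ t)
  have hF : MDP.Adapted F := fun t ρ ρ' h => by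
    have : (∃ u ≤ t, ρ u = dip n (e n + 1)) ↔ ∃ u ≤ t, ρ' u = dip n (e n + 1) :=
      exists_congr fun u => and_congr_right fun hu => by rw [h u hu]
    simp only [F, this, h t le_rfl]
  refine ((matching e).prob_le_of_superharmonic (wait 0 0) F hF (fun t ρ hp => ?_) T _
    fun ρ hρ _ => (if_pos hρ).ge).trans ?_
  · by_cases hv : ∃ u ≤ t, ρ u = dip n (e n + 1)
    · have h1 : F t ρ = 1 := if_pos hv
      rw [h1]
      refine (ENNReal.tsum_le_tsum fun s => ?_).trans_eq
        (PMF.tsum_coe ((matching e).next t (histOf ρ t)))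
      refine mul_le_of_le_one_right' (le_of_eq (if_pos ?_))
      obtain ⟨u, hu, hu'⟩ := hv
      exact ⟨u, hu.trans (Nat.le_succ t), by rw [MDP.update_eq_of_le _ _ _ hu, hu']⟩
    · have h1 : F t ρ = riskAhead e n t (ρ t) := if_neg hv
      rw [h1]
      refine le_trans (ENNReal.tsum_le_tsum fun s => ?_)
        (tsum_next_mul_riskAhead_le e hp fun hc => hv ⟨t, le_rfl, hc⟩)
      gcongr
      simp only [F, Function.update_self]
      split_ifs with h2
      · obtain ⟨u, hu, hu'⟩ := h2
        rcases Nat.lt_succ_iff_lt_or_eq.1 (Nat.lt_succ_of_le hu) with hlt | rfl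
        · rw [MDP.update_eq_of_le _ _ _ (Nat.lt_succ_iff.1 hlt)] at hu'
          exact absurd ⟨u, Nat.lt_succ_iff.1 hlt, hu'⟩ hv
        · rw [Function.update_self] at hu'
          rw [hu']
          simp [riskAhead]
      · exact le_rfl
  · simp only [F]
    rw [if_neg (by simp)]
    simp [riskAhead, show 0 < n by omega]

theorem prob_exists_eq_top_dip_le {n : ℕ} (hn : 1 ≤ n) :
    (matching e).prob (wait 0 0) {ρ | ∃ t, ρ t = dip n (e n + 1)} ≤ stageRisk (e n) := by
  have h : {ρ : ℕ → LadderState | ∃ t, ρ t = dip n (e n + 1)} =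
      ⋃ T, {ρ | ∃ t ≤ T, ρ t = dip n (e n + 1)} := by
    ext ρ
    simp only [Set.mem_ofPred_eq, Set.mem_iUnion]
    exact ⟨fun ⟨t, ht⟩ => ⟨t, t, le_rfl, ht⟩, fun ⟨_, t, _, ht⟩ => ⟨t, ht⟩⟩
  rw [h, Monotone.measure_iUnion]
  · exact iSup_le fun T => prob_exists_le_eq_top_dip_le e hn T
  · exact fun T T' hT ρ ⟨t, ht, hρ⟩ => ⟨t, ht.trans hT, hρ⟩

instance (σ : (mdp e).Strategy) : IsProbabilityMeasure (σ.prob (wait 0 0)) := by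
  unfold MDP.Strategy.prob
  infer_instance

/-- By Borel–Cantelli almost every run visits only finitely many top dips of stages `n ≥ 1`, and
every other dip is reached after its own delay. -/
theorem prob_matching_meanPayoff (h : ∑' n, stageRisk (e n) ≠ ⊤) :
    (matching e).prob (wait 0 0) (mdp e).meanPayoff = 1 := by
  have h1 : ∑' n, (matching e).prob (wait 0 0) {ρ | ∃ t, ρ t = dip (n + 1) (e (n + 1) + 1)} ≠ ⊤ := by
    refine ne_top_of_le_ne_top h ?_
    refine (ENNReal.tsum_le_tsum fun n => prob_exists_eq_top_dip_le e (Nat.succ_pos n)).trans ?_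
    exact ENNReal.tsum_comp_le_tsum_of_injective (Nat.succ_injective) fun n => stageRisk (e n)
  refine le_antisymm prob_le_one ?_
  rw [← measure_univ (μ := (matching e).prob (wait 0 0))]
  refine measure_mono_ae ?_
  filter_upwards [ae_eventually_notMem h1, (matching e).ae_isPlay (wait 0 0)] with ρ h2 h3 _
  obtain ⟨N, hN⟩ := Filter.eventually_atTop.1 h2
  refine mem_meanPayoff e (fun n => (h3 n).isPath) ⟨N + 1, fun t n j ht hn => ?_⟩
  have hm := matched_of_isPlay e (h3 t)
  have hr := reachable_of_isPath e (h3 t).isPath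
  rw [ht] at hm hr
  refine hm ?_
  by_contra hj
  obtain ⟨n, rfl⟩ : ∃ n', n = n' + 1 := ⟨n - 1, by omega⟩
  refine hN n (by omega) ⟨t, ?_⟩
  have := hr.1
  rw [ht, show j = e (n + 1) + 1 by omega]

theorem value_meanPayoff (h : ∑' n, stageRisk (e n) ≠ ⊤) :
    (mdp e).value (mdp e).meanPayoff (wait 0 0) = 1 :=
  le_antisymm (iSup_le fun _ => prob_le_one)
    ((prob_matching_meanPayoff e h).ge.trans (le_iSup (fun σ : (mdp e).Strategy =>
      σ.prob (wait 0 0) (mdp e).meanPayoff) (matching e)))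

/-! ### Choice of the stage sizes -/

/-- There are stage sizes that tend to infinity so slowly that a loss of order `(norm k)⁻¹` in
each stage is not summable. -/
theorem exists_stageSizes : ∃ e : ℕ → ℕ, (∀ K, {n | e n ≤ K}.Finite) ∧
    ∑' n, ((norm (e n) : ℕ) : ℝ≥0∞)⁻¹ = ⊤ ∧ ∑' n, stageRisk (e n) ≠ ⊤ := by
  -- Enumerating this sigma type makes each size `k` occur exactly `norm k` times. The two series
  -- become `∑ 1` and `∑ 2⁻¹ ^ (k + 1)`.
  have : Infinite (Σ k, Fin (norm k)) :=
    Infinite.of_injective (fun k => (⟨k, ⟨0, norm_pos k⟩⟩ : Σ k, Fin (norm k)))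
      fun _ _ h => congrArg Sigma.fst h
  obtain ⟨f⟩ := nonempty_equiv_of_countable (α := ℕ) (β := Σ k, Fin (norm k))
  have key : ∀ g : ℕ → ℝ≥0∞, ∑' n, g (f n).1 = ∑' k, (norm k : ℝ≥0∞) * g k := fun g => by
    rw [f.tsum_eq fun x => g x.1, ENNReal.tsum_sigma']
    simp
  have hn : ∀ k, (norm k : ℝ≥0∞) * ((norm k : ℕ) : ℝ≥0∞)⁻¹ = 1 := fun k =>
    ENNReal.mul_inv_cancel (by exact_mod_cast (norm_pos k).ne') (ENNReal.natCast_ne_top _)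
  refine ⟨fun n => (f n).1, fun K => ?_, ?_, ?_⟩
  · have : {n | (f n).1 ≤ K} = f ⁻¹' (⋃ k ∈ Set.Iic K, Set.range (Sigma.mk k)) := by
      ext n
      simp only [Set.mem_ofPred_eq, Set.mem_preimage, Set.mem_iUnion, Set.mem_Iic]
      exact ⟨fun h => ⟨_, h, (f n).2, rfl⟩, fun ⟨k, hk, x, hx⟩ => by rw [← hx]; exact hk⟩
    rw [this]
    exact ((Set.finite_Iic K).biUnion fun k _ => Set.finite_range _).preimage f.injective.injOn
  · rw [key fun k => ((norm k : ℕ) : ℝ≥0∞)⁻¹]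
    simp only [hn]
    exact ENNReal.tsum_const_eq_top_of_ne_zero one_ne_zero
  · rw [key stageRisk]
    have h1 : ∀ k, (norm k : ℝ≥0∞) * stageRisk k = 2⁻¹ ^ (k + 1) := by
      intro k
      have h2 : ((k + 1 : ℕ) : ℝ≥0∞) ≠ 0 := by exact_mod_cast Nat.succ_ne_zero k
      rw [stageRisk, mul_left_comm, ← mul_assoc (norm k : ℝ≥0∞), hn, one_mul, ratio, Nat.cast_mul,
        ENNReal.mul_inv (Or.inl h2) (Or.inl (ENNReal.natCast_ne_top _)), ← mul_assoc,
        ENNReal.mul_inv_cancel h2 (ENNReal.natCast_ne_top _), one_mul, Nat.cast_pow,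
        ENNReal.inv_pow, Nat.cast_ofNat]
    simp only [h1]
    rw [ENNReal.tsum_geometric_add_one]
    simp

end Ladder

/-! ### Finite memory loses almost surely -/

theorem PMF.tsum_bind_mul {α β : Type*} (p : PMF α) (f : α → PMF β) (g : β → ℝ≥0∞) :
    ∑' b, p.bind f b * g b = ∑' a, p a * ∑' b, f a b * g b := by
  simp only [PMF.bind_apply, ← ENNReal.tsum_mul_right, ← ENNReal.tsum_mul_left]
  rw [ENNReal.tsum_comm]
  simp only [mul_assoc]

theorem PMF.tsum_mul_one_sub {α : Type*} (p : PMF α) {f : α → ℝ≥0∞} (hf : ∀ a, f a ≤ 1) :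
    ∑' a, p a * (1 - f a) = 1 - ∑' a, p a * f a := by
  have h1 : ∑' a, p a * f a ≤ 1 :=
    (ENNReal.tsum_le_tsum fun a => mul_le_of_le_one_right' (hf a)).trans_eq p.tsum_coe
  refine ENNReal.eq_sub_of_add_eq (ne_top_of_le_ne_top ENNReal.one_ne_top h1) ?_
  rw [← ENNReal.tsum_add]
  simp only [← mul_add, tsub_add_cancel_of_le (hf _), mul_one, p.tsum_coe]

theorem PMF.tsum_map_fst {α β : Type*} (p : PMF (α × β)) (a : α) :
    ∑' b, p (a, b) = p.map Prod.fst a := by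
  classical
  rw [PMF.map_apply, ENNReal.tsum_prod', tsum_eq_single a fun a' ha' => by
    exact ENNReal.tsum_eq_zero.2 fun _ => if_neg fun h => ha' h.symm]
  simp

/-- If more than `card β` values of the first coordinate have prescribed probabilities, two of them
can be combined with the same second coordinate at a loss of a factor `card β`. -/
theorem PMF.exists_common_snd {β : Type*} [Fintype β] (p : PMF (ℕ × β)) {k : ℕ} {δ : ℕ → ℝ≥0∞}
    {L : ℕ → ℕ} (hp : ∀ i ≤ k, ∑' b, p (L i, b) = δ i) (hk : Fintype.card β ≤ k) :
    ∃ b i i', i < i' ∧ i' ≤ k ∧ δ i ≤ Fintype.card β * p (L i, b) ∧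
      δ i' ≤ Fintype.card β * p (L i', b) := by
  have hne : Nonempty β := by
    obtain ⟨x, -⟩ := p.support_nonempty
    exact ⟨x.2⟩
  have h : ∀ i : Fin (k + 1), ∃ b, δ i ≤ Fintype.card β * p (L i, b) := by
    intro i
    -- The most likely second coordinate carries at least a `1 / card β` share of the mass; with `k
    -- + 1 > card β` indices, two share the same one.
    obtain ⟨b, hb⟩ := Finite.exists_max fun b => p (L i, b)
    refine ⟨b, ?_⟩
    rw [← hp i (Nat.lt_succ_iff.1 i.2), tsum_fintype, ← nsmul_eq_mul]
    exact Finset.sum_le_card_nsmul _ _ _ fun b' _ => hb b'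
  choose f hf using h
  obtain ⟨i, i', hne', heq⟩ := Fintype.exists_ne_map_eq_of_card_lt f (by simp; omega)
  rcases lt_or_gt_of_ne hne' with hlt | hgt
  · exact ⟨f i, i, i', hlt, Nat.lt_succ_iff.1 i'.2, hf i, heq ▸ hf i'⟩
  · exact ⟨f i, i', i, hgt, Nat.lt_succ_iff.1 i.2, heq ▸ hf i', hf i⟩

namespace Ladder

open LadderState

variable {e : ℕ → ℕ} {Q : Type} (τ : (mdp e).Memory Q)

theorem tsum_step_mul_snd {m : Q} {s : LadderState} (hs : s ∉ (mdp e).ctrl)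
    (g : LadderState → ℝ≥0∞) :
    ∑' p, τ.step m s p * g p.2 = ∑' s', (mdp e).prob s s' * g s' := by
  rw [← τ.step_rand m s hs, PMF.tsum_map_mul]

theorem bet_notMem_ctrl (n j : ℕ) : bet n j ∉ (mdp e).ctrl := by
  rintro ⟨n, hn⟩; simp at hn

theorem dip_notMem_ctrl (n j : ℕ) : dip n j ∉ (mdp e).ctrl := by
  rintro ⟨n, hn⟩; simp at hn

/-- The remaining waiting time. -/
def waitTime : LadderState → ℕ
  | wait _ c => c
  | _ => 0

/-- The number chosen. -/
def choice : LadderState → ℕ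
  | bet _ j => j
  | _ => 0

/-- The law of the memory mode at the end of a waiting time. -/
noncomputable def waitMode (n : ℕ) : ℕ → Q → PMF Q
  | 0, m => PMF.pure m
  | c + 1, m => (τ.step m (wait n (c + 1))).bind fun p => waitMode n c p.1

/-- From stage `n₀` on, dips must not be deep relative to the elapsed time. -/
def Harmless (e : ℕ → ℕ) (n₀ t : ℕ) (s : LadderState) : Prop :=
  ∀ n j, s = dip n j → n₀ ≤ n → depth e n j < t

theorem safe_le_tsum (ok : ℕ → LadderState → Prop) (t : ℕ) (m : Q) (s : LadderState) :
    τ.safe ok t m s ≤ ∑' p, τ.step m s p * τ.safe ok (t + 1) p.1 p.2 := by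
  classical
  refine (τ.safe_le ok t m s).trans (ENNReal.tsum_le_tsum fun p => ?_)
  gcongr
  split_ifs
  · exact le_rfl
  · exact zero_le

theorem safe_wait_le (ok : ℕ → LadderState → Prop) (n : ℕ) : ∀ (c t : ℕ) (m : Q),
    τ.safe ok t m (wait n c) ≤ ∑' q, waitMode τ n c m q * τ.safe ok (t + c) q (wait n 0)
  | 0, t, m => by
    rw [waitMode, PMF.tsum_pure_mul, add_zero]
  | c + 1, t, m => by
    rw [waitMode, PMF.tsum_bind_mul]
    refine (safe_le_tsum τ ok t m _).trans (ENNReal.tsum_le_tsum fun p => ?_)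
    by_cases hp : τ.step m (wait n (c + 1)) p = 0
    · simp [hp]
    · have h1 : p.2 = wait n c := (trans_wait_succ e).1 (τ.trans_of_step_ne_zero hp)
      gcongr
      rw [h1, show t + (c + 1) = t + 1 + c by omega]
      exact safe_wait_le ok n c (t + 1) p.1

/-- The largest probability of staying safe after a dip of stage `n`. -/
noncomputable def stageSup (ok : ℕ → LadderState → Prop) (n : ℕ) : ℝ≥0∞ :=
  ⨆ (m : Q) (j : ℕ) (t : ℕ) (_ : t + 1 ≤ depth e (n + 1) 0), τ.safe ok t m (dip n j)

theorem safe_le_stageSup (ok : ℕ → LadderState → Prop) {n t : ℕ} (m : Q) (j : ℕ)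
    (ht : t + 1 ≤ depth e (n + 1) 0) : τ.safe ok t m (dip n j) ≤ stageSup τ ok n :=
  le_iSup_of_le m (le_iSup_of_le j (le_iSup_of_le t (le_iSup_of_le ht le_rfl)))

theorem stageSup_le_one (ok : ℕ → LadderState → Prop) (n : ℕ) : stageSup τ ok n ≤ 1 :=
  iSup_le fun m => iSup_le fun _ => iSup_le fun t => iSup_le fun _ => τ.safe_le_one ok t m _

/-- The probability that choosing `j` at time `u` leads to a harmful dip. -/
noncomputable def loss (e : ℕ → ℕ) (n u j : ℕ) : ℝ≥0∞ :=
  if u + 2 ≤ depth e n j then 1 else risk (e n) j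

theorem loss_le_one (n u j : ℕ) : loss e n u j ≤ 1 := by
  unfold loss
  split_ifs
  · exact le_rfl
  · exact risk_le_one _ _

theorem risk_le_loss (n u j : ℕ) : risk (e n) j ≤ loss e n u j := by
  unfold loss
  split_ifs
  · exact risk_le_one _ _
  · exact le_rfl

theorem safe_bet_le_stageSup (ok : ℕ → LadderState → Prop) {n t : ℕ} (m : Q) (j : ℕ)
    (ht : t + 2 ≤ depth e (n + 1) 0) : τ.safe ok t m (bet n j) ≤ stageSup τ ok n := by
  refine (safe_le_tsum τ ok t m _).trans (le_trans (ENNReal.tsum_le_tsum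
    (g := fun p => τ.step m (bet n j) p * stageSup τ ok n) fun p => ?_) ?_)
  · by_cases hp : τ.step m (bet n j) p = 0
    · simp [hp]
    · gcongr
      obtain h1 | h1 := (trans_bet e).1 (τ.trans_of_step_ne_zero hp) <;> rw [h1] <;>
        exact safe_le_stageSup τ ok _ _ ht
  · rw [ENNReal.tsum_mul_right, PMF.tsum_coe, one_mul]

/-- At this time the top dip is always harmful. If `dip n j` is harmful too, safety is impossible;
otherwise it requires that the risk is not realized. -/
theorem safe_bet_le {n₀ n u j : ℕ} (m : Q) (hn : n₀ ≤ n) (hj : j ≤ e n)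
    (hu : u + 2 ≤ depth e n (e n + 1)) (hu' : u + 3 ≤ depth e (n + 1) 0) :
    τ.safe (Harmless e n₀) (u + 1) m (bet n j) ≤
      stageSup τ (Harmless e n₀) n * (1 - loss e n u j) := by
  classical
  have htop : ¬ Harmless e n₀ (u + 1 + 1) (dip n (e n + 1)) := fun h => by
    have := h n _ rfl hn
    omega
  refine (τ.safe_le _ _ _ _).trans ?_
  by_cases hd : u + 2 ≤ depth e n j
  · refine le_of_eq_of_le (ENNReal.tsum_eq_zero.2 fun p => ?_) zero_le
    have hdip : ¬ Harmless e n₀ (u + 1 + 1) (dip n j) := fun h => by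
      have := h n j rfl hn
      omega
    by_cases hp : τ.step m (bet n j) p = 0
    · simp [hp]
    · obtain h1 | h1 := (trans_bet e).1 (τ.trans_of_step_ne_zero hp) <;> rw [h1]
      · rw [if_neg hdip, mul_zero]
      · rw [if_neg htop, mul_zero]
  · rw [loss, if_neg hd, ← prob_bet_dip e hj]
    calc _ ≤ ∑' p : Q × LadderState, τ.step m (bet n j) p *
          (if p.2 = dip n j then stageSup τ (Harmless e n₀) n else 0) := by
          refine ENNReal.tsum_le_tsum fun p => ?_
          by_cases hp : τ.step m (bet n j) p = 0
          · simp [hp]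
          · gcongr
            by_cases h2 : p.2 = dip n j
            · rw [if_pos h2, h2]
              split_ifs
              · exact safe_le_stageSup τ _ _ _ hu'
              · exact zero_le
            · obtain h1 | h1 := (trans_bet e).1 (τ.trans_of_step_ne_zero hp)
              · exact absurd h1 h2
              · rw [h1, if_neg htop]
                exact zero_le
      _ = _ := by
          rw [tsum_step_mul_snd τ (bet_notMem_ctrl n j)
            fun s => if s = dip n j then stageSup τ (Harmless e n₀) n else 0,
            tsum_eq_single (dip n j) fun s hs => by rw [if_neg hs, mul_zero], if_pos rfl, mul_comm]

/-- The probability of a harmful dip in stage `n` if the decision is made in mode `q` at time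
`u`. -/
noncomputable def modeLoss (n u : ℕ) (q : Q) : ℝ≥0∞ :=
  ∑' p, τ.step q (wait n 0) p * loss e n u (choice p.2)

theorem modeLoss_le_one (n u : ℕ) (q : Q) : modeLoss τ n u q ≤ 1 :=
  (ENNReal.tsum_le_tsum fun _ => mul_le_of_le_one_right' (loss_le_one _ _ _)).trans_eq
    (PMF.tsum_coe _)

theorem safe_wait_zero_le_stageSup (ok : ℕ → LadderState → Prop) {n u : ℕ} (q : Q)
    (hu' : u + 3 ≤ depth e (n + 1) 0) : τ.safe ok u q (wait n 0) ≤ stageSup τ ok n := by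
  refine (safe_le_tsum τ ok u q _).trans (le_trans (ENNReal.tsum_le_tsum
    (g := fun p => τ.step q (wait n 0) p * stageSup τ ok n) fun p => ?_) ?_)
  · by_cases hp : τ.step q (wait n 0) p = 0
    · simp [hp]
    · gcongr
      obtain ⟨j, -, h1⟩ := (trans_wait_zero e).1 (τ.trans_of_step_ne_zero hp)
      rw [← h1]
      exact safe_bet_le_stageSup τ ok _ _ hu'
  · rw [ENNReal.tsum_mul_right, PMF.tsum_coe, one_mul]

theorem safe_wait_zero_le {n₀ n u : ℕ} (q : Q) (hn : n₀ ≤ n)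
    (hu : u + 2 ≤ depth e n (e n + 1)) (hu' : u + 3 ≤ depth e (n + 1) 0) :
    τ.safe (Harmless e n₀) u q (wait n 0) ≤
      stageSup τ (Harmless e n₀) n * (1 - modeLoss τ n u q) := by
  rw [modeLoss, ← PMF.tsum_mul_one_sub _ fun p => loss_le_one _ _ _, ← ENNReal.tsum_mul_left]
  refine (safe_le_tsum τ _ u q _).trans (ENNReal.tsum_le_tsum fun p => ?_)
  rw [mul_left_comm]
  by_cases hp : τ.step q (wait n 0) p = 0
  · simp [hp]
  · gcongr
    obtain ⟨j, hj, h1⟩ := (trans_wait_zero e).1 (τ.trans_of_step_ne_zero hp)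
    rw [← h1]
    exact safe_bet_le τ _ hn hj hu hu'

/-- The joint law of the delay and of the mode in which the next decision is made. -/
noncomputable def delayMode (n : ℕ) (m : Q) (j : ℕ) : PMF (ℕ × Q) :=
  (τ.step m (dip n j)).bind fun p =>
    (waitMode τ (n + 1) (waitTime p.2) p.1).map (Prod.mk (waitTime p.2))

theorem exists_delay_of_delayMode_ne_zero {n j : ℕ} {m : Q} {x : ℕ × Q}
    (hx : delayMode τ n m j x ≠ 0) : ∃ i ≤ e (n + 1), delay e (n + 1) i = x.1 := by
  have h := (PMF.mem_support_bind_iff _ _ _).1 hx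
  obtain ⟨p, hp, h⟩ := h
  rw [PMF.support_map] at h
  obtain ⟨q, -, rfl⟩ := h
  obtain ⟨i, hi, h1⟩ := (trans_dip e).1 (τ.trans_of_step_ne_zero hp)
  exact ⟨i, hi, by rw [← h1]; rfl⟩

theorem tsum_delayMode (n : ℕ) (m : Q) (j i : ℕ) :
    ∑' q, delayMode τ n m j (delay e (n + 1) i, q) = delayProb (e (n + 1)) i := by
  have h1 : (delayMode τ n m j).map Prod.fst =
      (delayIndex (e (n + 1))).map fun i => delay e (n + 1) i := by
    have h2 : (delayMode τ n m j).map Prod.fst = (τ.step m (dip n j)).map (waitTime ∘ Prod.snd) := by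
      rw [delayMode, PMF.map_bind, ← PMF.bind_pure_comp]
      congr 1
      funext p
      rw [PMF.map_comp]
      exact PMF.map_const _ _
    rw [h2, ← PMF.map_comp, τ.step_rand m _ (dip_notMem_ctrl n j)]
    change PMF.map _ (PMF.map _ _) = _
    rw [PMF.map_comp]
    rfl
  rw [PMF.tsum_map_fst, h1, PMF.map_apply, tsum_eq_single i]
  · rw [if_pos rfl]
    rfl
  · intro i' hi'
    exact if_neg fun h => hi' (delay_injective e (Nat.succ_pos n) h).symm

theorem safe_dip_le (ok : ℕ → LadderState → Prop) (n t : ℕ) (m : Q) (j : ℕ) :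
    τ.safe ok t m (dip n j) ≤
      ∑' x, delayMode τ n m j x * τ.safe ok (t + 1 + x.1) x.2 (wait (n + 1) 0) := by
  rw [delayMode, PMF.tsum_bind_mul]
  refine (safe_le_tsum τ ok t m _).trans (ENNReal.tsum_le_tsum fun p => ?_)
  by_cases hp : τ.step m (dip n j) p = 0
  · simp [hp]
  · gcongr
    obtain ⟨i, hi, h1⟩ := (trans_dip e).1 (τ.trans_of_step_ne_zero hp)
    rw [PMF.tsum_map_mul, ← h1]
    exact safe_wait_le τ ok (n + 1) _ (t + 1) p.1

/-- Safety after a dip of stage `n` is at most an average of safety probabilities after dips of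
stage `n + 1`. This covers the stages that are too small for the pigeonhole argument. -/
theorem stageSup_le_succ (ok : ℕ → LadderState → Prop) (n : ℕ) :
    stageSup τ ok n ≤ stageSup τ ok (n + 1) := by
  refine iSup_le fun m => iSup_le fun j => iSup_le fun t => iSup_le fun ht => ?_
  refine (safe_dip_le τ ok n t m j).trans (le_trans (ENNReal.tsum_le_tsum
    (g := fun x => delayMode τ n m j x * stageSup τ ok (n + 1)) fun x => ?_) ?_)
  · by_cases hx : delayMode τ n m j x = 0
    · simp [hx]
    · gcongr
      obtain ⟨i, hi, h1⟩ := exists_delay_of_delayMode_ne_zero τ hx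
      have := depth_zero_add_delay_le_next e (n + 1) hi
      exact safe_wait_zero_le_stageSup τ ok _ (by omega)
  · rw [ENNReal.tsum_mul_right, PMF.tsum_coe, one_mul]

/-- In mode `q` the choice has the same law at both decision times, so it suffices to bound the
combined loss for each number `j`: if `j > i` the dip is too deep after delay `i`, and if `j ≤ i`
the risk is too large for the probability of `i'`. -/
theorem inv_norm_le_delayProb_mul_modeLoss {n u u' i i' : ℕ} (q : Q) (hi : i < i') (hi' : i' ≤ e n)
    (hu : u ≤ depth e n 0 + delay e n i) :
    ((norm (e n) : ℕ) : ℝ≥0∞)⁻¹ ≤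
      delayProb (e n) i * modeLoss τ n u q + delayProb (e n) i' * modeLoss τ n u' q := by
  rw [modeLoss, modeLoss, ← ENNReal.tsum_mul_left, ← ENNReal.tsum_mul_left, ← ENNReal.tsum_add]
  calc ((norm (e n) : ℕ) : ℝ≥0∞)⁻¹ = ∑' p, τ.step q (wait n 0) p * ((norm (e n) : ℕ) : ℝ≥0∞)⁻¹ := by
        rw [ENNReal.tsum_mul_right, PMF.tsum_coe, one_mul]
    _ ≤ _ := ENNReal.tsum_le_tsum fun p => ?_
  rw [mul_left_comm, mul_left_comm (delayProb (e n) i'), ← mul_add]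
  gcongr
  by_cases hj : i < choice p.2
  · have h1 := depth_zero_add_delay_lt e n hj
    refine le_trans ?_ le_self_add
    rw [loss, if_pos (by omega), mul_one]
    exact inv_norm_le_delayProb (by omega)
  · refine le_trans ?_ le_add_self
    refine (inv_norm_le_delayProb_mul_risk hi hi').trans ?_
    gcongr
    exact (risk_anti _ (not_lt.1 hj)).trans (risk_le_loss _ _ _)

/-- Safety through stage `n + 1` costs a factor `1 - Y`, where `Y` is the expected loss there. The
pigeonhole principle bounds `Y` below, and `(1 - Y) * (1 + Y) ≤ 1` turns the loss into growth. -/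
theorem stageSup_mul_le_succ [Fintype Q] {n₀ n : ℕ} (hn : n₀ ≤ n + 1)
    (hQ : Fintype.card Q ≤ e (n + 1)) :
    stageSup τ (Harmless e n₀) n * (1 + ((norm (e (n + 1)) : ℕ) : ℝ≥0∞)⁻¹ / Fintype.card Q) ≤
      stageSup τ (Harmless e n₀) (n + 1) := by
  conv_lhs => rw [stageSup]
  simp only [ENNReal.iSup_mul]
  refine iSup_le fun m => iSup_le fun j => iSup_le fun t => iSup_le fun ht => ?_
  set A := stageSup τ (Harmless e n₀) (n + 1)
  set Y := ∑' x, delayMode τ n m j x * modeLoss τ (n + 1) (t + 1 + x.1) x.2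
  have hY1 : Y ≤ 1 :=
    (ENNReal.tsum_le_tsum fun _ => mul_le_of_le_one_right' (modeLoss_le_one _ _ _ _)).trans_eq
      (PMF.tsum_coe _)
  have hsafe : τ.safe (Harmless e n₀) t m (dip n j) ≤ A * (1 - Y) := by
    rw [← PMF.tsum_mul_one_sub _ fun x => modeLoss_le_one _ _ _ _, ← ENNReal.tsum_mul_left]
    refine (safe_dip_le τ _ n t m j).trans (ENNReal.tsum_le_tsum fun x => ?_)
    rw [mul_left_comm]
    by_cases hx : delayMode τ n m j x = 0
    · simp [hx]
    · gcongr
      obtain ⟨i, hi, h1⟩ := exists_delay_of_delayMode_ne_zero τ hx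
      have h2 := depth_zero_add_delay_le_next e (n + 1) hi
      have h3 := depth_zero_add_delay_lt e (n + 1) (Nat.lt_succ_of_le hi)
      exact safe_wait_zero_le τ _ hn (by simp only [Nat.succ_eq_add_one] at h3; omega) (by omega)
  have hY : ((norm (e (n + 1)) : ℕ) : ℝ≥0∞)⁻¹ / Fintype.card Q ≤ Y := by
    refine ENNReal.div_le_of_le_mul' ?_
    obtain ⟨q, i, i', hii', hi', h1, h2⟩ := (delayMode τ n m j).exists_common_snd
      (fun i _ => tsum_delayMode τ n m j i) hQ
    refine (inv_norm_le_delayProb_mul_modeLoss τ (u := t + 1 + delay e (n + 1) i)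
      (u' := t + 1 + delay e (n + 1) i') q hii' hi' (by omega)).trans ?_
    have hne : (delay e (n + 1) i, q) ≠ (delay e (n + 1) i', q) := fun h =>
      hii'.ne (delay_injective e (Nat.succ_pos n) (congrArg Prod.fst h))
    classical
    have h3 := ENNReal.sum_le_tsum (f := fun x : ℕ × Q =>
      delayMode τ n m j x * modeLoss τ (n + 1) (t + 1 + x.1) x.2)
      {(delay e (n + 1) i, q), (delay e (n + 1) i', q)}
    rw [Finset.sum_pair hne] at h3
    refine le_trans ?_ (mul_le_mul_right h3 _)
    rw [mul_add, ← mul_assoc, ← mul_assoc]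
    gcongr
  calc _ ≤ A * (1 - Y) * (1 + Y) := by gcongr
    _ ≤ A * ((1 - Y) + Y) := by
        rw [mul_assoc, mul_add, mul_one]
        gcongr
        exact mul_le_of_le_one_left' tsub_le_self
    _ = A := by rw [tsub_add_cancel_of_le hY1, mul_one]

open Classical in
-- Iterating the growth estimate and using `∏ (1 + c n) ≥ 1 + ∑ c n`, a positive start would exceed
-- the bound `1`.
theorem stageSup_zero_eq_zero [Fintype Q] (he : ∀ K, {n | e n ≤ K}.Finite)
    (hsum : ∑' n, ((norm (e n) : ℕ) : ℝ≥0∞)⁻¹ = ⊤) (n₀ : ℕ) :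
    stageSup τ (Harmless e n₀) 0 = 0 := by
  let c : ℕ → ℝ≥0∞ := fun n => if n₀ ≤ n + 1 ∧ Fintype.card Q ≤ e (n + 1) then
    ((norm (e (n + 1)) : ℕ) : ℝ≥0∞)⁻¹ / Fintype.card Q else 0
  have hc : ∀ n, stageSup τ (Harmless e n₀) n * (1 + c n) ≤ stageSup τ (Harmless e n₀) (n + 1) := by
    intro n
    by_cases h : n₀ ≤ n + 1 ∧ Fintype.card Q ≤ e (n + 1)
    · simp only [c, if_pos h]
      exact stageSup_mul_le_succ τ h.1 h.2
    · simp only [c, if_neg h, add_zero, mul_one]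
      exact stageSup_le_succ τ _ n
  have hd : ∀ d, stageSup τ (Harmless e n₀) 0 * (1 + ∑ n ∈ range d, c n) ≤
      stageSup τ (Harmless e n₀) d := by
    intro d
    induction d with
    | zero => simp
    | succ d ih =>
      refine le_trans ?_ (hc d)
      refine le_trans ?_ (mul_le_mul_left ih _)
      rw [Finset.sum_range_succ, mul_assoc]
      gcongr
      rw [mul_add, mul_one, ← add_assoc]
      gcongr
      exact le_mul_of_one_le_left' le_self_add
  have htop : ∑' n, c n = ⊤ := by
    by_contra hne
    -- Only finitely many stages are too early or too small to contribute to `c`; dropping them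
    -- keeps the series divergent. Stage `0` is excluded because `c n` refers to stage `n + 1`.
    have hfin : ({n | n < n₀} ∪ {n | e n ≤ Fintype.card Q} ∪ {0}).Finite :=
      ((Set.finite_lt_nat n₀).union (he _)).union (Set.finite_singleton 0)
    have hbound : ∀ n, ((norm (e n) : ℕ) : ℝ≥0∞)⁻¹ ≤
        (if n ∈ hfin.toFinset then 1 else 0) + Fintype.card Q * (c (n - 1)) := by
      intro n
      by_cases hn : n ∈ hfin.toFinset
      · rw [if_pos hn]
        refine le_trans ?_ le_self_add
        rw [ENNReal.inv_le_one]
        exact_mod_cast norm_pos _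
      · rw [if_neg hn, zero_add]
        simp only [Set.Finite.mem_toFinset, Set.mem_union, Set.mem_ofPred_eq,
          Set.mem_singleton_iff, not_or, not_lt, not_le] at hn
        obtain ⟨⟨h1, h2⟩, h3⟩ := hn
        obtain ⟨n, rfl⟩ := Nat.exists_eq_succ_of_ne_zero h3
        have h4 : c (n + 1 - 1) = ((norm (e (n + 1)) : ℕ) : ℝ≥0∞)⁻¹ / Fintype.card Q :=
          if_pos ⟨h1, h2.le⟩
        have h5 : (Fintype.card Q : ℝ≥0∞) ≠ 0 := by
          have : 0 < Fintype.card Q := Fintype.card_pos_iff.2 ⟨τ.init⟩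
          exact_mod_cast this.ne'
        rw [Nat.succ_eq_add_one, h4, ENNReal.mul_div_cancel h5 (ENNReal.natCast_ne_top _)]
    have h6 : ∑' n, c (n - 1) ≠ ⊤ := by
      rw [tsum_eq_zero_add' ENNReal.summable]
      simp only [add_tsub_cancel_right]
      exact ENNReal.add_ne_top.2 ⟨ENNReal.ne_top_of_tsum_ne_top hne _, hne⟩
    have h7 := ENNReal.tsum_le_tsum hbound
    rw [hsum, ENNReal.tsum_add, ENNReal.tsum_mul_left, top_le_iff] at h7
    refine ENNReal.add_ne_top.2 ⟨?_, ENNReal.mul_ne_top (ENNReal.natCast_ne_top _) h6⟩ h7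
    rw [tsum_eq_sum (s := hfin.toFinset) fun n hn => if_neg hn]
    exact ENNReal.sum_ne_top.2 fun n _ => by split_ifs; all_goals simp
  have hle : stageSup τ (Harmless e n₀) 0 * ∑' n, c n ≤ 1 := by
    rw [ENNReal.tsum_eq_iSup_nat, ENNReal.mul_iSup]
    exact iSup_le fun d => (mul_le_mul_right le_add_self _).trans
      ((hd d).trans (stageSup_le_one τ _ d))
  by_contra h0
  rw [htop, ENNReal.mul_top h0] at hle
  exact absurd hle (by simp)

/-- For every `n₀`, a harmful dip almost surely occurs at or after stage `n₀`. Intersecting over the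
countably many `n₀` gives infinitely many harmful dips. -/
theorem prob_meanPayoff_eq_zero (he : ∀ K, {n | e n ≤ K}.Finite)
    (hsum : ∑' n, ((norm (e n) : ℕ) : ℝ≥0∞)⁻¹ = ⊤) (σ : (mdp e).Strategy)
    (hσ : σ.FiniteMemory (wait 0 0)) : σ.prob (wait 0 0) (mdp e).meanPayoff = 0 := by
  obtain ⟨Q, hQ, τ, hτ⟩ := hσ
  have := Fintype.ofFinite Q
  have h1 : ∀ n₀, σ.prob (wait 0 0) {ρ | ∀ t, Harmless e n₀ t (ρ t)} = 0 := by
    intro n₀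
    refine le_antisymm ?_ zero_le
    refine (hτ.prob_safe_le (Harmless e n₀)).trans ?_
    rw [← stageSup_zero_eq_zero τ he hsum n₀]
    refine safe_wait_zero_le_stageSup τ _ _ ?_
    have := depth_zero_add_delay_le_next e 0 (Nat.zero_le (e 0))
    omega
  have h2 : ∀ᵐ ρ ∂σ.prob (wait 0 0), ∀ n₀, ¬ ∀ t, Harmless e n₀ t (ρ t) :=
    ae_all_iff.2 fun n₀ => measure_eq_zero_iff_ae_notMem.1 (h1 n₀)
  rw [measure_eq_zero_iff_ae_notMem]
  filter_upwards [h2, σ.ae_isPlay (wait 0 0)] with ρ h3 h4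
  refine notMem_meanPayoff e (fun n => (h4 n).isPath) fun N => ?_
  have h5 := h3 N
  simp only [Harmless, not_forall, not_lt] at h5
  obtain ⟨t, n, j, h6, h7, h8⟩ := h5
  exact ⟨t, n, j, h6, h7, h8⟩

end Ladder

theorem mainTheorem5 :
    ∃ (S : Type) (_ : Countable S) (_ : MeasurableSpace S) (_ : DiscreteMeasurableSpace S)
      (M : MDP S) (s₀ : S),
      M.FinitelyBranching ∧ M.Acyclic ∧ M.RewardImplicit s₀ ∧
      M.value M.meanPayoff s₀ = 1 ∧
      (∀ σ : M.Strategy, σ.FiniteMemory s₀ → σ.prob s₀ M.meanPayoff = 0) ∧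
      (∀ ε : ℝ, 0 ≤ ε → ε < 1 → ∀ σ : M.Strategy, σ.FiniteMemoryRewardCounter s₀ →
        ¬ σ.EpsOptimal M.meanPayoff s₀ ε) := by
  obtain ⟨e, he, hdiv, hconv⟩ := Ladder.exists_stageSizes
  have hzero := Ladder.prob_meanPayoff_eq_zero he hdiv
  have hval := Ladder.value_meanPayoff e hconv
  refine ⟨LadderState, inferInstance, inferInstance, inferInstance, Ladder.mdp e,
    LadderState.wait 0 0, Ladder.finitelyBranching e, Ladder.acyclic e, Ladder.rewardImplicit e,
    hval, hzero, fun ε _ hε σ hσ hopt => ?_⟩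
  rw [MDP.Strategy.EpsOptimal, hval, hzero σ (hσ.finiteMemory (Ladder.reward_eq e) rfl), zero_add,
    ENNReal.one_le_ofReal] at hopt
  linarith
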